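/- Let $U$ be a locally compact second countable group, and let $X, X'$ be locally compact second countable Hausdorff (equivalently, metrizable) spaces on which $U$ acts continuously and locally freely; locally free means that for every compact set $K$ of points there is a neighbourhood $V$ of the identity in $U$ such that $u\mapsto u.x$ is injective on $V$ for every $x\in K$. Let a semi-direct product $\langle a\rangle\ltimes U$ act on both $X$ and $X'$ extending these actions, with $a$ acting by homeomorphisms. Assume that $U$ is equipped with a metric $d$ inducing its topology such that, for some constants $c,C>1$, $$c\,d(u_1,u_2)\le d(au_1a^{-1},au_2a^{-1})\le C\,d(u_1,u_2)\qquad\text{for all }u_1,u_2\in U .$$ Let $\pi:X\to X'$ be a Borel measurable map with finite fibres that intertwines the actions of $\langle a\rangle\ltimes U$ on $X$ and $X'$. Let $\mu$ be an $a$-invariant Borel probability measure on $X$ and let $\mu'=\pi_*\mu$. Then for $\mu$-a.e. $x\in X$ $$\mu_x^U=(\mu')^U_{\pi(x)},$$ an equality of proportionality classes (up to positive constants) of Radon measures on $U$. Here leafwise measures are understood as follows. For a $\sigma$-algebra $\mathcal A$ on $X$, let $[x]_{\mathcal A}$ be the atom of $x$ and $V_x=\{u\in U: u.x\in[x]_{\mathcal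 A}\}$. A countably generated $\sigma$-algebra $\mathcal A$ of Borel sets is subordinate to $U$ on $Y\subset X$ if for every $x\in Y$ there are a neighbourhood $B$ of the identity in $U$ and a compact $K\subset U$ with $B.x\subset[x]_{\mathcal A}\subset K.x$. A system of $U$-leafwise measures of $\mu$ is a Borel measurable family $x\mapsto\mu_x^U$ of Radon measures on $U$ such that, for every such $\mathcal A$ and $Y$, for $\mu$-a.e. $x\in Y$ the conditional measure $\mu_x^{\mathcal A}$ is proportional to the push-forward of $\mu_x^U|_{V_x}$ under $u\mapsto u.x$; and similarly for $\mu'$ on $X'$. The claim holds for every choice of systems of leafwise measures of $\mu$ and of $\mu'$. -/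

import Mathlib

open MeasureTheory ProbabilityTheory Topology

/-- A locally compact second countable Hausdorff space is Polish: it is open in its completion for
any compatible metric. In particular its Borel structure is standard, so that conditional measures
(`condExpKernel`) are available on it. -/
instance (priority := 50) polishSpace_of_locallyCompact_secondCountable (X : Type*)
    [TopologicalSpace X] [T2Space X] [LocallyCompactSpace X] [SecondCountableTopology X] :
    PolishSpace X := by
  let _ : MetricSpace X := TopologicalSpace.metrizableSpaceMetric X
  have hemb : IsEmbedding ((↑) : X → UniformSpace.Completion X) :=
    UniformSpace.Completion.isUniformEmbedding_coe X |>.isEmbedding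
  have hdense : DenseRange ((↑) : X → UniformSpace.Completion X) :=
    UniformSpace.Completion.denseRange_coe
  have hopen : IsOpen (Set.range ((↑) : X → UniformSpace.Completion X)) := by
    rw [isOpen_iff_mem_nhds]
    rintro _ ⟨x, rfl⟩
    obtain ⟨K, hK, hxK⟩ := exists_compact_mem_nhds x
    rw [hemb.nhds_eq_comap, Filter.mem_comap] at hxK
    obtain ⟨t, ht, htK⟩ := hxK
    obtain ⟨V, hVt, hV, hxV⟩ := mem_nhds_iff.1 ht
    refine Filter.mem_of_superset (hV.mem_nhds hxV) ?_
    have hKc : IsClosed (((↑) : X → UniformSpace.Completion X) '' K) :=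
      (hK.image hemb.continuous).isClosed
    have h1 : V ⊆ closure (V ∩ Set.range ((↑) : X → UniformSpace.Completion X)) :=
      hdense.open_subset_closure_inter hV
    have h2 : V ∩ Set.range ((↑) : X → UniformSpace.Completion X) ⊆
        ((↑) : X → UniformSpace.Completion X) '' K := by
      rintro _ ⟨hy, y, rfl⟩
      exact ⟨y, htK (hVt hy), rfl⟩
    exact (h1.trans (closure_minimal h2 hKc)).trans (Set.image_subset_range _ _)
  have : SecondCountableTopology (UniformSpace.Completion X) := inferInstance
  have : PolishSpace (UniformSpace.Completion X) := inferInstance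
  have := hopen.polishSpace
  exact hemb.toHomeomorph.isClosedEmbedding.polishSpace

/-- Two measures are proportional if they agree up to a positive finite constant. -/
def Proportional {U : Type*} {_ : MeasurableSpace U} (ν ν' : Measure U) : Prop :=
  ∃ c : ENNReal, c ≠ 0 ∧ c ≠ ⊤ ∧ ν = c • ν'

/-- The action of `U` on `X` is locally free: uniformly over compact sets of points `x`, the orbit
map `u ↦ u • x` is injective near the identity. -/
def LocallyFreeAction (U X : Type*) [Group U] [TopologicalSpace U] [TopologicalSpace X]
    [MulAction U X] : Prop :=
  ∀ K : Set X, IsCompact K → ∃ V ∈ 𝓝 (1 : U), ∀ x ∈ K, Set.InjOn (fun u : U => u • x) V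

/-- The atom `[x]_𝓐` is a `U`-plaque for `x`: it contains `B • x` for some neighbourhood `B` of the
identity in `U` and is contained in `K • x` for some compact `K ⊆ U`. (For any proper metric on `U`
this says `B_δ • x ⊆ [x]_𝓐 ⊆ B_{1/δ} • x` for some `δ > 0`.) -/
def IsPlaque (U : Type*) {X : Type*} [Group U] [TopologicalSpace U] [MulAction U X]
    (𝓐 : MeasurableSpace X) (x : X) : Prop :=
  (∃ B ∈ 𝓝 (1 : U), (fun u : U => u • x) '' B ⊆ @measurableAtom X 𝓐 x) ∧
    ∃ K : Set U, IsCompact K ∧ @measurableAtom X 𝓐 x ⊆ (fun u : U => u • x) '' K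

/-- `𝓐` is a countably generated sub-σ-algebra of the σ-algebra `𝓑` on `X` which is subordinate
to `U` on `Y`: the atom of every point of `Y` is a `U`-plaque. -/
structure SubordinateOn (U : Type*) {X : Type*} [Group U] [TopologicalSpace U] [MulAction U X]
    (𝓑 𝓐 : MeasurableSpace X) (Y : Set X) : Prop where
  le : 𝓐 ≤ 𝓑
  countablyGenerated : @MeasurableSpace.CountablyGenerated X 𝓐
  isPlaque : ∀ x ∈ Y, IsPlaque U 𝓐 x

/-- The conditional measure `μ_x^𝓐` of `μ` at `x` with respect to the σ-algebra `𝓐`. -/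
noncomputable def condMeasure {X : Type*} (𝓐 : MeasurableSpace X) {𝓑 : MeasurableSpace X}
    [StandardBorelSpace X] (μ : Measure X) [IsFiniteMeasure μ] (x : X) : Measure X :=
  condExpKernel μ 𝓐 x

/-- The set `V_x` of those `u : U` for which `u • x` lies in the atom `[x]_𝓐`. -/
def plaqueSet (U : Type*) {X : Type*} [Group U] [MulAction U X] (𝓐 : MeasurableSpace X) (x : X) :
    Set U :=
  {u : U | u • x ∈ @measurableAtom X 𝓐 x}

/-- The measure `(ν|_{V_x}).x` on `X`: the push-forward of the restriction of `ν` to `V_x` under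
the orbit map `u ↦ u • x`. -/
noncomputable def plaqueMeasure {U X : Type*} [Group U] [MulAction U X] (𝓐 : MeasurableSpace X)
    {𝓑 : MeasurableSpace X} [MeasurableSpace U] (ν : Measure U) (x : X) : Measure X :=
  Measure.map (fun u : U => u • x) (ν.restrict (plaqueSet U 𝓐 x))

/-- `m` is a system of `U`-leafwise measures for the finite measure `μ` on `X`: a measurable family
of Radon measures on `U` such that for every countably generated σ-algebra `𝓐` of Borel sets
subordinate to `U` on a set `Y`, for `μ`-almost every `x ∈ Y` the conditional measure `μ_x^𝓐` is
proportional to `((m x)|_{V_x}).x`. This determines the measures `m x` up to proportionality and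
outside a `μ`-null set when almost every point has trivial stabilizer; the measure `m x` represents
the proportionality class `μ_x^U`. -/
structure IsLeafwiseSystem {U X : Type*} [Group U] [TopologicalSpace U] [MeasurableSpace U]
    [MulAction U X] [𝓑 : MeasurableSpace X] [StandardBorelSpace X]
    (μ : Measure X) [IsFiniteMeasure μ] (m : X → Measure U) : Prop where
  measurable : Measurable m
  locallyFinite : ∀ x, IsLocallyFiniteMeasure (m x)
  conditional : ∀ (𝓐 : MeasurableSpace X) (Y : Set X), SubordinateOn U 𝓑 𝓐 Y →
    ∀ᵐ x ∂μ, x ∈ Y → Proportional (condMeasure 𝓐 μ x) (plaqueMeasure 𝓐 (m x) x)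

/-! Write `μ' = μ.map π` and let `λ` be the measure on `X` obtained by putting the uniform
probability measure on almost every fibre over `μ'`. Every point lies in its own finite fibre, so `μ
≪ λ`. As `a` permutes the fibres, `λ` is `a`-invariant, and so is the density `ρ = dμ/dλ` up to null
sets. Since `a` expands `U`, the Hopf argument gives a version of `ρ` that is constant on `U`-orbits
(`exists_smul_invariant_density`).

Take a σ-algebra `𝓐'` downstairs whose atoms are plaques. The conditional measures of `μ` for
`π⁻¹𝓐'` are those of `μ'`, spread uniformly over the fibres and weighted by `ρ`
(`condExpKernel_comap_ae_eq`). Joining with a plaque σ-algebra `𝓐` upstairs cuts the atoms down to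
pieces of single orbits. Stabilizers are almost surely trivial, so such a piece meets the fibre over
`u • π x` in at most the point `u • x`. Fibre cardinality and `ρ` are both constant along the orbit,
so only a constant distinguishes the two leafwise measures on the common plaque
(`ae_proportional_restrict`).

To pass from plaques to all of `U`, pull the σ-algebras back by `a⁻ⁿ`, which enlarges plaque windows
by `θⁿ`. By Poincaré recurrence almost every point returns to a fixed good set for infinitely many
`n`, so every ball is eventually covered. The constants for different balls agree because the
leafwise measure downstairs charges every neighbourhood of the identity. -/

/-! ### Universal measurability of analytic sets -/

/-- Analytic subsets of a metrizable space can be approximated in measure from inside by compact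
sets. -/
theorem MeasureTheory.AnalyticSet.exists_isCompact_le_measure {Y : Type*} [TopologicalSpace Y]
    [TopologicalSpace.MetrizableSpace Y] [MeasurableSpace Y] [BorelSpace Y] {s : Set Y}
    (hs : AnalyticSet s) (ν : Measure Y) [IsFiniteMeasure ν] {a : ENNReal} (ha : a < ν s) :
    ∃ K ⊆ s, IsCompact K ∧ a ≤ ν K := by
  let _ : MetricSpace Y := TopologicalSpace.metrizableSpaceMetric Y
  rw [AnalyticSet_def] at hs
  rcases hs with rfl | ⟨f, hf, rfl⟩
  · simp at ha
  -- Bound one coordinate at a time while keeping the mass of the image above `a`. Continuity from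
  -- below holds for arbitrary increasing sets, so the images need not be measurable.
  have step : ∀ (n : ℕ) (t : {t : Set (ℕ → ℕ) // a < ν (f '' t)}),
      ∃ k : ℕ, a < ν (f '' (t.1 ∩ {x | x n ≤ k})) := by
    intro n t
    have hmono : Monotone fun k : ℕ => f '' (t.1 ∩ {x | x n ≤ k}) := by
      intro k l hkl
      exact Set.image_mono (Set.inter_subset_inter_right _ fun x hx => le_trans hx hkl)
    have hU : ⋃ k : ℕ, f '' (t.1 ∩ {x | x n ≤ k}) = f '' t.1 := by
      rw [← Set.image_iUnion, ← Set.inter_iUnion]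
      congr 1
      refine Set.inter_eq_left.2 fun x _ => Set.mem_iUnion.2 ⟨x n, le_refl (x n)⟩
    have h := t.2
    rw [← hU, hmono.measure_iUnion] at h
    exact lt_iSup_iff.1 h
  choose k hk using step
  let t : ℕ → {t : Set (ℕ → ℕ) // a < ν (f '' t)} := fun n =>
    Nat.rec ⟨Set.univ, by rwa [Set.image_univ]⟩ (fun n t => ⟨t.1 ∩ {x | x n ≤ k n t}, hk n t⟩) n
  have htsucc : ∀ n, (t (n + 1)).1 = (t n).1 ∩ {x | x n ≤ k n (t n)} := fun n => rfl
  have htanti : Antitone fun n => (t n).1 :=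
    antitone_nat_of_succ_le fun n => by rw [htsucc]; exact Set.inter_subset_left
  have htle : ∀ {n : ℕ} {x : ℕ → ℕ}, x ∈ (t n).1 → ∀ i < n, x i ≤ k i (t i) := by
    intro n x hx i hi
    have : x ∈ (t (i + 1)).1 := htanti hi hx
    rw [htsucc] at this
    exact this.2
  have hK : IsCompact (Set.univ.pi fun i => Set.Iic (k i (t i))) :=
    isCompact_univ_pi fun i => (Set.finite_Iic _).isCompact
  refine ⟨f '' Set.univ.pi fun i => Set.Iic (k i (t i)), Set.image_subset_range _ _, hK.image hf, ?_⟩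
  have hsub : ⋂ n, closure (f '' (t n).1) ⊆ f '' Set.univ.pi fun i => Set.Iic (k i (t i)) := by
    intro y hy
    have h1 : ∀ n : ℕ, ∃ x ∈ (t n).1, dist (f x) y < 1 / ((n : ℝ) + 1) := by
      intro n
      obtain ⟨_, ⟨x, hx, rfl⟩, hd⟩ :=
        Metric.mem_closure_iff.1 (Set.mem_iInter.1 hy n) (1 / ((n : ℝ) + 1)) Nat.one_div_pos_of_nat
      exact ⟨x, hx, by rwa [dist_comm]⟩
    choose x hx hd using h1
    -- Truncation moves `x n` into the compact box. It leaves coordinate `i` unchanged once `n > i`,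
    -- so limits of the truncated and the original sequence coincide.
    obtain ⟨z, hz, φ, hφ, hlim⟩ := hK.tendsto_subseq
      (x := fun n i => min (x n i) (k i (t i))) (fun n i _ => Set.mem_Iic.2 (min_le_right (x n i) _))
    have hlim' : Filter.Tendsto (fun n => x (φ n)) Filter.atTop (𝓝 z) := by
      rw [tendsto_pi_nhds] at hlim ⊢
      intro i
      refine (hlim i).congr' ?_
      filter_upwards [Filter.eventually_gt_atTop i] with n hn
      exact min_eq_left (htle (hx (φ n)) i (hn.trans_le (hφ.id_le n)))
    have h2 : Filter.Tendsto (fun n => f (x n)) Filter.atTop (𝓝 y) :=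
      tendsto_iff_dist_tendsto_zero.2 (squeeze_zero (fun _ => dist_nonneg) (fun n => (hd n).le)
        tendsto_one_div_add_atTop_nhds_zero_nat)
    exact ⟨z, hz, tendsto_nhds_unique ((hf.tendsto z).comp hlim') (h2.comp hφ.tendsto_atTop)⟩
  refine le_trans ?_ (measure_mono hsub)
  have hanti : Antitone fun n => closure (f '' (t n).1) := fun m n hmn =>
    closure_mono (Set.image_mono (htanti hmn))
  rw [hanti.measure_iInter (fun n => isClosed_closure.measurableSet.nullMeasurableSet)
    ⟨0, measure_ne_top _ _⟩]
  exact le_iInf fun n => (t n).2.le.trans (measure_mono subset_closure)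

/-- Analytic sets are universally measurable. -/
theorem MeasureTheory.AnalyticSet.nullMeasurableSet {Y : Type*} [TopologicalSpace Y]
    [TopologicalSpace.MetrizableSpace Y] [MeasurableSpace Y] [BorelSpace Y] {s : Set Y}
    (hs : AnalyticSet s) (ν : Measure Y) [IsFiniteMeasure ν] : NullMeasurableSet s ν := by
  rcases eq_or_ne (ν s) 0 with h0 | h0
  · exact NullMeasurableSet.of_null h0
  obtain ⟨a, -, ha, hlim⟩ := exists_seq_strictMono_tendsto' (pos_iff_ne_zero.2 h0)
  choose K hKs hK hKa using fun n => hs.exists_isCompact_le_measure ν (ha n).2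
  have hm : MeasurableSet (⋃ n, K n) := MeasurableSet.iUnion fun n => (hK n).measurableSet
  have hle : ν s ≤ ν (⋃ n, K n) :=
    le_of_tendsto' hlim fun n => (hKa n).trans (measure_mono (Set.subset_iUnion K n))
  have h1 : ⋃ n, K n =ᵐ[ν] toMeasurable ν s :=
    ae_eq_of_subset_of_measure_ge ((Set.iUnion_subset hKs).trans (subset_toMeasurable ν s))
      (by rwa [measure_toMeasurable]) hm.nullMeasurableSet (measure_ne_top _ _)
  refine ⟨⋃ n, K n, hm, ?_⟩
  have h2 : ⋃ n, K n ≤ᵐ[ν] s := (Set.iUnion_subset hKs).eventuallyLE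
  have h3 : s ≤ᵐ[ν] toMeasurable ν s := (subset_toMeasurable ν s).eventuallyLE
  exact (h3.trans h1.symm.le).antisymm h2

/-! ### Uniform measures on finite fibres -/

/-- The fibres of a finite-to-one Borel map depend measurably on the base point, off a null set. -/
theorem exists_measurable_count_fiber {X X' : Type*} [TopologicalSpace X] [PolishSpace X]
    [MeasurableSpace X] [BorelSpace X] [TopologicalSpace X'] [TopologicalSpace.MetrizableSpace X']
    [SecondCountableTopology X'] [MeasurableSpace X'] [BorelSpace X'] {π : X → X'}
    (hπ : Measurable π) (hfin : ∀ x', (π ⁻¹' {x'}).Finite) (ν : Measure X') [IsFiniteMeasure ν] :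
    ∃ X₀ : Set X', MeasurableSet X₀ ∧ ν X₀ᶜ = 0 ∧ ∀ A : Set X, MeasurableSet A →
      Measurable (X₀.indicator fun x' => Measure.count (A ∩ π ⁻¹' {x'})) := by
  -- Adding the empty set makes the family nonempty, so that it can be enumerated by `ℕ` even if `X`
  -- is empty.
  obtain ⟨b, hb⟩ := ((TopologicalSpace.countable_countableBasis X).insert ∅).exists_eq_range
    (Set.insert_nonempty _ _)
  have hbo : ∀ n, IsOpen (b n) := by
    intro n
    have : b n ∈ insert ∅ (TopologicalSpace.countableBasis X) := hb ▸ Set.mem_range_self n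
    rcases this with h | h
    · rw [h]; exact isOpen_empty
    · exact TopologicalSpace.isOpen_of_mem_countableBasis h
  have hbb : ∀ (x : X) (O : Set X), IsOpen O → x ∈ O → ∃ n, x ∈ b n ∧ b n ⊆ O := by
    intro x O hO hx
    obtain ⟨P, hP, hxP, hPO⟩ :=
      (TopologicalSpace.isBasis_countableBasis X).exists_subset_of_mem_open hx hO
    obtain ⟨n, rfl⟩ : P ∈ Set.range b := hb ▸ Set.mem_insert_of_mem _ hP
    exact ⟨n, hxP, hPO⟩
  have himg : ∀ A : Set X, MeasurableSet A → NullMeasurableSet (π '' A) ν := fun A hA =>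
    (hA.analyticSet_image hπ).nullMeasurableSet ν
  -- `S n` consists of the points with exactly one preimage in `b n`: no `b k` separates two
  -- preimages there. Finite fibres are discrete, so each point of `X` is isolated in its fibre by
  -- some `b n`.
  let S : ℕ → Set X' := fun n => π '' b n \ ⋃ k, (π '' (b n ∩ b k) ∩ π '' (b n ∩ (b k)ᶜ))
  have hS : ∀ n, NullMeasurableSet (S n) ν := fun n =>
    (himg _ (hbo n).measurableSet).diff (NullMeasurableSet.iUnion fun k =>
      (himg _ ((hbo n).measurableSet.inter (hbo k).measurableSet)).inter
        (himg _ ((hbo n).measurableSet.inter (hbo k).measurableSet.compl)))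
  choose t htS htm hae using fun n => (hS n).exists_measurable_subset_ae_eq
  have hnull : ν (⋃ n, S n \ t n) = 0 :=
    measure_iUnion_null fun n => (ae_eq_set.1 (hae n)).2
  let E : ℕ → Set X := fun n => b n ∩ π ⁻¹' t n
  have hEm : ∀ n, MeasurableSet (E n) := fun n => (hbo n).measurableSet.inter (hπ (htm n))
  have hinj : ∀ n, Set.InjOn π (E n) := by
    intro n x hx y hy hxy
    by_contra hne
    obtain ⟨k, hxk, hk⟩ := hbb x {y}ᶜ isOpen_compl_singleton hne
    refine (htS n hx.2).2 (Set.mem_iUnion.2 ⟨k, ⟨x, ⟨hx.1, hxk⟩, rfl⟩, ⟨y, ⟨hy.1, ?_⟩, hxy.symm⟩⟩)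
    exact fun hyk => hk hyk rfl
  have hcov : ∀ x, π x ∉ ⋃ n, S n \ t n → ∃ n, x ∈ E n := by
    intro x hx
    obtain ⟨n, hxn, hn⟩ := hbb x (π ⁻¹' {π x} \ {x})ᶜ
      ((hfin (π x)).subset Set.sdiff_subset).isClosed.isOpen_compl (by simp)
    have hy : ∀ y ∈ b n, π y = π x → y = x := by
      intro y hyn hyx
      by_contra hne
      exact hn hyn ⟨hyx, hne⟩
    have hxS : π x ∈ S n := by
      refine ⟨⟨x, hxn, rfl⟩, fun h => ?_⟩
      obtain ⟨k, ⟨y, hyk, hyx⟩, ⟨z, hzk, hzx⟩⟩ := Set.mem_iUnion.1 h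
      rw [hy y hyk.1 hyx] at hyk
      rw [hy z hzk.1 hzx] at hzk
      exact hzk.2 hyk.2
    refine ⟨n, hxn, ?_⟩
    by_contra hxt
    exact hx (Set.mem_iUnion.2 ⟨n, hxS, hxt⟩)
  refine ⟨(toMeasurable ν (⋃ n, S n \ t n))ᶜ, (measurableSet_toMeasurable _ _).compl, ?_, ?_⟩
  · rw [compl_compl, measure_toMeasurable, hnull]
  intro A hA
  have hDm : ∀ n, MeasurableSet (disjointed E n) := fun n => MeasurableSet.disjointed hEm n
  have hDE : ∀ n, Set.InjOn π (A ∩ disjointed E n) := fun n =>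
    (hinj n).mono (Set.inter_subset_right.trans (disjointed_subset E n))
  -- By Lusin–Souslin, injective Borel images are Borel; the count is a sum of their indicators.
  have key : Measurable fun x' => ∑' n, (π '' (A ∩ disjointed E n)).indicator
      (fun _ => (1 : ENNReal)) x' :=
    Measurable.tsum fun n => measurable_const.indicator
      ((hA.inter (hDm n)).image_of_measurable_injOn hπ (hDE n))
  convert key.indicator (measurableSet_toMeasurable ν (⋃ n, S n \ t n)).compl using 1
  refine Set.indicator_congr fun x' hx' => ?_
  have hx'' : x' ∉ ⋃ n, S n \ t n := fun h => hx' (subset_toMeasurable _ _ h)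
  have h1 : A ∩ π ⁻¹' {x'} = ⋃ n, (A ∩ disjointed E n) ∩ π ⁻¹' {x'} := by
    rw [← Set.iUnion_inter, ← Set.inter_iUnion, iUnion_disjointed]
    ext x
    constructor
    · rintro ⟨hx, rfl⟩
      obtain ⟨n, hn⟩ := hcov x hx''
      exact ⟨⟨hx, Set.mem_iUnion.2 ⟨n, hn⟩⟩, rfl⟩
    · exact fun h => ⟨h.1.1, h.2⟩
  rw [h1, measure_iUnion]
  · refine tsum_congr fun n => ?_
    by_cases h : x' ∈ π '' (A ∩ disjointed E n)
    · rw [Set.indicator_of_mem h]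
      obtain ⟨x, hx, rfl⟩ := h
      have : A ∩ disjointed E n ∩ π ⁻¹' {π x} = {x} := by
        ext y
        exact ⟨fun hy => hDE n hy.1 hx hy.2, by rintro rfl; exact ⟨hx, rfl⟩⟩
      rw [this, Measure.count_singleton]
    · rw [Set.indicator_of_notMem h]
      have : A ∩ disjointed E n ∩ π ⁻¹' {x'} = ∅ := by
        ext y
        simp only [Set.mem_inter_iff, Set.mem_empty_iff_false, iff_false]
        exact fun hy => h ⟨y, hy.1, hy.2⟩
      rw [this, measure_empty]
  · intro i j hij
    exact (disjoint_disjointed E hij).mono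
      (Set.inter_subset_left.trans Set.inter_subset_right)
      (Set.inter_subset_left.trans Set.inter_subset_right)
  · exact fun n => (hA.inter (hDm n)).inter (hπ (measurableSet_singleton _))

theorem ProbabilityTheory.uniformOn_image_of_injective {Ω Ω' : Type*} [MeasurableSpace Ω]
    [MeasurableSingletonClass Ω] [MeasurableSpace Ω'] [MeasurableSingletonClass Ω'] {f : Ω → Ω'}
    (hf : Function.Injective f) {s : Set Ω} (hs : s.Finite) (A : Set Ω') :
    uniformOn (f '' s) A = uniformOn s (f ⁻¹' A) := by
  rw [uniformOn, uniformOn, cond_apply (hs.image f).measurableSet, cond_apply hs.measurableSet,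
    Measure.count_injective_image hf, ← Set.image_inter_preimage, Measure.count_injective_image hf]

theorem ProbabilityTheory.lintegral_uniformOn {Ω : Type*} [MeasurableSpace Ω]
    [MeasurableSingletonClass Ω] {s : Set Ω} (hs : s.Finite) (f : Ω → ENNReal) :
    ∫⁻ y, f y ∂uniformOn s = (Measure.count s)⁻¹ * ∑ y ∈ hs.toFinset, f y := by
  rw [uniformOn, cond, lintegral_smul_measure, smul_eq_mul]
  congr 1
  have h : (s : Set Ω) = (hs.toFinset : Set Ω) := hs.coe_toFinset.symm
  conv_lhs => rw [h]
  rw [lintegral_finset]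
  simp

/-- The uniform measures on the fibres of a finite-to-one Borel map form a kernel, off a null
set. -/
theorem exists_kernel_uniformOn_fiber {X X' : Type*} [TopologicalSpace X] [PolishSpace X]
    [MeasurableSpace X] [BorelSpace X] [TopologicalSpace X'] [TopologicalSpace.MetrizableSpace X']
    [SecondCountableTopology X'] [MeasurableSpace X'] [BorelSpace X'] {π : X → X'}
    (hπ : Measurable π) (hfin : ∀ x', (π ⁻¹' {x'}).Finite) (ν : Measure X') [IsFiniteMeasure ν] :
    ∃ σ : Kernel X' X, IsFiniteKernel σ ∧ ∀ᵐ x' ∂ν, σ x' = uniformOn (π ⁻¹' {x'}) := by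
  classical
  obtain ⟨X₀, hX₀, hν, hm⟩ := exists_measurable_count_fiber hπ hfin ν
  have hmeas : Measurable fun x' => if x' ∈ X₀ then uniformOn (π ⁻¹' {x'}) else 0 := by
    refine Measure.measurable_of_measurable_coe _ fun A hA => ?_
    have h1 := (hm Set.univ MeasurableSet.univ).inv.mul (hm A hA)
    convert h1.indicator hX₀ using 1
    ext x'
    by_cases hx' : x' ∈ X₀
    · simp only [Set.indicator_of_mem hx', if_pos hx', Pi.mul_apply, Pi.inv_apply, Set.univ_inter]
      rw [uniformOn, cond_apply (hfin x').measurableSet, Set.inter_comm A]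
    · simp [hx']
  refine ⟨⟨_, hmeas⟩, ⟨⟨1, ENNReal.one_lt_top, fun x' => ?_⟩⟩, ?_⟩
  · change (if x' ∈ X₀ then uniformOn (π ⁻¹' {x'}) else 0) Set.univ ≤ 1
    split_ifs
    · exact prob_le_one
    · simp
  · have : ∀ᵐ x' ∂ν, x' ∈ X₀ := hν
    filter_upwards [this] with x' hx'
    exact if_pos hx'

section

variable {X X' : Type*} [MeasurableSpace X] [MeasurableSingletonClass X] [MeasurableSpace X']
  {π : X → X'} {μ : Measure X} {σ : Kernel X' X}

/-- If the right-hand side vanishes on `A`, almost every fibre misses `A`; but `x` belongs to the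
fibre over `π x`. -/
theorem absolutelyContinuous_bind_uniformOn_fiber (hπ : Measurable π)
    (hfin : ∀ x', (π ⁻¹' {x'}).Finite) (hσ : ∀ᵐ x' ∂μ.map π, σ x' = uniformOn (π ⁻¹' {x'})) :
    μ ≪ (μ.map π).bind σ := by
  refine Measure.AbsolutelyContinuous.mk fun A hA h0 => ?_
  rw [Measure.bind_apply hA σ.aemeasurable, lintegral_eq_zero_iff (σ.measurable_coe hA)] at h0
  have h1 : ∀ᵐ x' ∂μ.map π, π ⁻¹' {x'} ∩ A = ∅ := by
    filter_upwards [h0, hσ] with x' h2 h3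
    rw [h3] at h2
    exact (uniformOn_eq_zero_iff (hfin x')).1 h2
  have h2 := ae_of_ae_map hπ.aemeasurable h1
  rw [measure_eq_zero_iff_ae_notMem]
  filter_upwards [h2] with x hx hxA
  have : x ∈ π ⁻¹' {π x} ∩ A := ⟨rfl, hxA⟩
  rw [hx] at this
  exact this

/-- `T` maps the fibre over `x'` bijectively onto the fibre over `T' x'`, hence carries uniform
measure to uniform measure. -/
theorem measurePreserving_bind_uniformOn_fiber (hπ : Measurable π)
    (hfin : ∀ x', (π ⁻¹' {x'}).Finite) (hσ : ∀ᵐ x' ∂μ.map π, σ x' = uniformOn (π ⁻¹' {x'}))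
    (T : X ≃ᵐ X) (T' : X' ≃ᵐ X') (hπT : ∀ x, π (T x) = T' (π x)) (hμ : MeasurePreserving T μ μ) :
    MeasurePreserving T ((μ.map π).bind σ) ((μ.map π).bind σ) := by
  have hT' : MeasurePreserving T' (μ.map π) (μ.map π) := by
    refine ⟨T'.measurable, ?_⟩
    rw [Measure.map_map T'.measurable hπ]
    conv_rhs => rw [← hμ.map_eq, Measure.map_map hπ T.measurable]
    congr 1
    ext x
    exact (hπT x).symm
  refine ⟨T.measurable, Measure.ext fun A hA => ?_⟩
  rw [Measure.map_apply T.measurable hA, Measure.bind_apply (T.measurable hA) σ.aemeasurable,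
    Measure.bind_apply hA σ.aemeasurable, ← hT'.lintegral_comp (σ.measurable_coe hA)]
  refine lintegral_congr_ae ?_
  filter_upwards [hσ, hT'.quasiMeasurePreserving.ae hσ] with x' h1 h2
  rw [h1, h2, ← uniformOn_image_of_injective T.injective (hfin x')]
  congr 2
  ext x
  constructor
  · rintro ⟨y, rfl, rfl⟩
    exact hπT y
  · intro hx
    refine ⟨T.symm x, ?_, T.apply_symm_apply x⟩
    have : T' (π (T.symm x)) = T' x' := by rw [← hπT, T.apply_symm_apply]; exact hx
    exact T'.injective this

end

/-! ### The Hopf argument -/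

theorem HasCompactSupport.eventually_forall_dist_smul_lt {U X : Type*} [Group U]
    [TopologicalSpace U] [IsTopologicalGroup U] [LocallyCompactSpace U] [TopologicalSpace X]
    [MulAction U X] [ContinuousSMul U X] {g : X → ℝ} (hg : HasCompactSupport g)
    (hc : Continuous g) {ε : ℝ} (hε : 0 < ε) :
    ∀ᶠ u in 𝓝 (1 : U), ∀ x, dist (g (u • x)) (g x) < ε := by
  obtain ⟨W, hW, hW1⟩ := exists_compact_mem_nhds (1 : U)
  have hK : IsCompact ((fun p : U × X => p.1 • p.2) '' (W⁻¹ ×ˢ tsupport g) ∪ tsupport g) :=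
    ((hW.inv.prod hg.isCompact).image continuous_smul).union hg.isCompact
  have h1 : ∀ᶠ u in 𝓝 (1 : U), ∀ x ∈ (fun p : U × X => p.1 • p.2) '' (W⁻¹ ×ˢ tsupport g) ∪
      tsupport g, dist (g (u • x)) (g x) < ε := by
    refine hK.eventually_forall_of_forall_eventually fun x _ => ?_
    have hcont : Continuous fun p : U × X => dist (g (p.1 • p.2)) (g p.2) := by fun_prop
    refine hcont.continuousAt.eventually_lt continuousAt_const ?_
    simpa using hε
  filter_upwards [h1, hW1] with u hu huW x
  by_cases hx : x ∈ (fun p : U × X => p.1 • p.2) '' (W⁻¹ ×ˢ tsupport g) ∪ tsupport g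
  · exact hu x hx
  · rw [Set.mem_union, not_or] at hx
    have hux : u • x ∉ tsupport g := fun hux =>
      hx.1 ⟨(u⁻¹, u • x), ⟨Set.inv_mem_inv.2 huW, hux⟩, inv_smul_smul u x⟩
    rw [image_eq_zero_of_notMem_tsupport hx.2, image_eq_zero_of_notMem_tsupport hux]
    simpa using hε

theorem symm_iterate_smul {U X : Type*} [Group U] [MulAction U X] {θ : U ≃* U} {T : X ≃ X}
    (hT : ∀ (u : U) (x : X), T (u • x) = θ u • T x) (n : ℕ) (u : U) (x : X) :
    T.symm^[n] (u • x) = θ.symm^[n] u • T.symm^[n] x := by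
  induction n generalizing u x with
  | zero => rfl
  | succ n ih =>
    rw [Function.iterate_succ_apply, Function.iterate_succ_apply, Function.iterate_succ_apply, ← ih]
    congr 1
    apply T.injective
    rw [hT, T.apply_symm_apply, T.apply_symm_apply, θ.apply_symm_apply]

/-- Expansion gives `c ^ n * dist (θ⁻ⁿ u) 1 ≤ dist u 1`, so backward iterates shrink every ball into
`V`. -/
theorem tendsto_symm_iterate_one {U : Type*} [Group U] [PseudoMetricSpace U] {θ : U ≃* U} {c : ℝ}
    (hc : 1 < c) (hexp : ∀ u₁ u₂ : U, c * dist u₁ u₂ ≤ dist (θ u₁) (θ u₂)) {V : Set U}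
    (hV : V ∈ 𝓝 (1 : U)) (R : ℝ) :
    ∀ᶠ n : ℕ in Filter.atTop, ∀ u ∈ Metric.closedBall (1 : U) R, θ.symm^[n] u ∈ V := by
  obtain ⟨δ, hδ, hδV⟩ := Metric.mem_nhds_iff.1 hV
  have h0 : 0 < c := zero_lt_one.trans hc
  have hbound : ∀ (n : ℕ) (u : U), c ^ n * dist (θ.symm^[n] u) 1 ≤ dist u 1 := by
    intro n
    induction n with
    | zero => simp
    | succ n ih =>
      intro u
      rw [Function.iterate_succ_apply, pow_succ, mul_comm (c ^ n), mul_assoc]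
      refine (mul_le_mul_of_nonneg_left (ih (θ.symm u)) h0.le).trans ?_
      have := hexp (θ.symm u) 1
      rwa [θ.apply_symm_apply, map_one] at this
  have hlim : Filter.Tendsto (fun n : ℕ => δ * c ^ n) Filter.atTop Filter.atTop :=
    (tendsto_pow_atTop_atTop_of_one_lt hc).const_mul_atTop hδ
  filter_upwards [hlim.eventually_gt_atTop R] with n hn u hu
  refine hδV (Metric.mem_ball.2 ?_)
  have h1 := (hbound n u).trans (Metric.mem_closedBall.1 hu)
  have h2 : 0 < c ^ n := pow_pos h0 n
  by_contra hcon
  rw [not_lt] at hcon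
  nlinarith

/-- The Hopf argument: a `T`-invariant function is almost everywhere equal to a function which is
invariant under a group that is uniformly expanded by `T`. -/
theorem exists_smul_invariant_ae_eq {U X : Type*} [Group U] [MetricSpace U] [IsTopologicalGroup U]
    [LocallyCompactSpace U] [TopologicalSpace X] [T2Space X] [LocallyCompactSpace X]
    [SecondCountableTopology X] [MeasurableSpace X] [BorelSpace X] [MulAction U X]
    [ContinuousSMul U X] {θ : U ≃* U} {T : X ≃ₜ X}
    (hT : ∀ (u : U) (x : X), T (u • x) = θ u • T x) {c : ℝ} (hc : 1 < c)
    (hexp : ∀ u₁ u₂ : U, c * dist u₁ u₂ ≤ dist (θ u₁) (θ u₂)) {μ : Measure X} [IsFiniteMeasure μ]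
    (hμ : MeasurePreserving T μ μ) {ρ : X → ℝ} (hρ : Integrable ρ μ)
    (hρT : (fun x => ρ (T x)) =ᵐ[μ] ρ) :
    ∃ ρ' : X → ℝ, Measurable ρ' ∧ (∀ (u : U) (x : X), ρ' (u • x) = ρ' x) ∧ ρ' =ᵐ[μ] ρ := by
  have hμs : MeasurePreserving T.symm μ μ := hμ.symm T.toMeasurableEquiv
  have hρn : ∀ n : ℕ, (fun x => ρ (T.symm^[n] x)) =ᵐ[μ] ρ := by
    intro n
    induction n with
    | zero => rfl
    | succ n ih =>
      have h1 := (hμs.iterate (n + 1)).quasiMeasurePreserving.ae_eq_comp hρT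
      filter_upwards [h1, ih] with x h2 h3
      rw [← h3]
      simp only [Function.comp_apply, Function.iterate_succ_apply', T.apply_symm_apply] at h2 ⊢
      exact h2.symm
  have hg := fun j : ℕ => (memLp_one_iff_integrable.2 hρ).exists_hasCompactSupport_eLpNorm_sub_le
    ENNReal.one_ne_top (ε := ((j : ENNReal) + 1)⁻¹) (by simp)
  choose g hgs hgε hgc hgL using hg
  have hV : ∀ j : ℕ, {u : U | ∀ x, dist (g j (u • x)) (g j x) < 1 / ((j : ℝ) + 1)} ∈ 𝓝 (1 : U) :=
    fun j => (hgs j).eventually_forall_dist_smul_lt (hgc j) Nat.one_div_pos_of_nat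
  -- After `n j` backward steps the ball of radius `j` moves points so little that `g j` changes by
  -- less than `1 / (j + 1)`.
  choose n hn using fun j : ℕ => (tendsto_symm_iterate_one hc hexp (hV j) j).exists
  let h : ℕ → X → ℝ := fun j x => g j (T.symm^[n j] x)
  have hTn : ∀ m : ℕ, Continuous (T.symm^[m]) := fun m => T.symm.continuous.iterate m
  have hhc : ∀ j, Continuous (h j) := fun j => (hgc j).comp (hTn _)
  have hnorm : ∀ j, eLpNorm (h j - ρ) 1 μ ≤ ((j : ENNReal) + 1)⁻¹ := by
    intro j
    have h1 : h j - ρ =ᵐ[μ] (g j - ρ) ∘ T.symm^[n j] := by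
      filter_upwards [hρn (n j)] with x hx
      simp [h, hx]
    rw [eLpNorm_congr_ae h1, eLpNorm_comp_measurePreserving
      ((hgc j).aestronglyMeasurable.sub hρ.1) (hμs.iterate _), ← eLpNorm_neg, neg_sub]
    exact hgε j
  have hlim : Filter.Tendsto (fun j => eLpNorm (h j - ρ) 1 μ) Filter.atTop (𝓝 0) := by
    refine tendsto_of_tendsto_of_tendsto_of_le_of_le tendsto_const_nhds ?_ (fun _ => zero_le) hnorm
    have := (ENNReal.tendsto_inv_nat_nhds_zero).comp (Filter.tendsto_add_atTop_nat 1)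
    simpa [Function.comp_def] using this
  obtain ⟨ns, hns, hae⟩ := (tendstoInMeasure_of_tendsto_eLpNorm one_ne_zero
    (fun j => (hhc j).aestronglyMeasurable) hρ.1 hlim).exists_seq_tendsto_ae
  refine ⟨fun x => Filter.limUnder Filter.atTop fun j => h (ns j) x, ?_, ?_, ?_⟩
  · exact (StronglyMeasurable.limUnder fun j => (hhc (ns j)).stronglyMeasurable).measurable
  · intro u x
    have hdiff : Filter.Tendsto (fun j => dist (h (ns j) (u • x)) (h (ns j) x)) Filter.atTop
        (𝓝 0) := by
      have h0 : Filter.Tendsto (fun j => 1 / ((ns j : ℝ) + 1)) Filter.atTop (𝓝 0) :=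
        tendsto_one_div_add_atTop_nhds_zero_nat.comp hns.tendsto_atTop
      refine squeeze_zero' (Filter.Eventually.of_forall fun _ => dist_nonneg) ?_ h0
      filter_upwards [(tendsto_natCast_atTop_atTop.comp hns.tendsto_atTop).eventually_ge_atTop
        (dist u 1)] with j hj
      have h2 := hn (ns j) u (Metric.mem_closedBall.2 hj) (T.symm^[n (ns j)] x)
      have h3 := symm_iterate_smul (T := T.toEquiv) hT (n (ns j)) u x
      have h4 : T.symm^[n (ns j)] (u • x) = θ.symm^[n (ns j)] u • T.symm^[n (ns j)] x := h3
      exact (h4 ▸ h2 : dist (g (ns j) (T.symm^[n (ns j)] (u • x))) _ < _).le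
    -- The two sequences have the same limits, so the chosen values agree even where no limit
    -- exists. Invariance therefore holds everywhere, not just almost everywhere.
    simp only [Filter.limUnder, Filter.lim]
    congr 1
    ext a
    exact (tendsto_iff_of_dist hdiff)
  · filter_upwards [hae] with x hx
    exact hx.limUnder_eq

/-! ### Conditional measures and their atoms -/

section

variable {Ω : Type*} {m : MeasurableSpace Ω} [mΩ : MeasurableSpace Ω] [StandardBorelSpace Ω]
  {μ : Measure Ω} [IsFiniteMeasure μ]

theorem setLIntegral_lintegral_condExpKernel (hm : m ≤ mΩ) {E : Set Ω} (hE : MeasurableSet[m] E)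
    {f : Ω → ENNReal} (hf : Measurable f) :
    ∫⁻ x in E, ∫⁻ y, f y ∂condExpKernel μ m x ∂μ = ∫⁻ x in E, f x ∂μ := by
  rw [← setLIntegral_trim hm hf.lintegral_kernel hE]
  have h1 : Measurable[m.prod mΩ] fun p : Ω × Ω => f p.2 :=
    @Measurable.comp _ _ _ (m.prod mΩ) mΩ _ _ _ hf (@measurable_snd _ _ m mΩ)
  have h2 := @Measure.setLIntegral_compProd Ω Ω m mΩ (μ.trim hm) (condExpKernel μ m) _ _
    (fun p => f p.2) h1
    E hE Set.univ MeasurableSet.univ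
  simp only [Measure.restrict_univ] at h2
  have hd : @Measurable _ _ mΩ (m.prod mΩ) (Function.diag : Ω → Ω × Ω) :=
    Measurable.prodMk (measurable_id.mono le_rfl hm) measurable_id
  rw [← h2, compProd_trim_condExpKernel hm, @setLIntegral_map _ _ mΩ (m.prod mΩ) _ _ _ _
    (@MeasurableSet.prod _ _ m mΩ _ _ hE MeasurableSet.univ)
    h1 hd]
  simp [Function.diag, Set.preimage]

theorem ae_ae_condExpKernel (hm : m ≤ mΩ) {p : Ω → Prop} (h : ∀ᵐ x ∂μ, p x) :
    ∀ᵐ x ∂μ, ∀ᵐ y ∂condExpKernel μ m x, p y := by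
  refine ae_of_ae_trim hm (Measure.ae_ae_of_ae_comp ?_)
  rwa [condExpKernel_comp_trim hm]

theorem condExpKernel_apply_ae_eq (hm : m ≤ mΩ) {A : Set Ω} (hA : MeasurableSet A)
    {f : Ω → ENNReal} (hf : Measurable[m] f)
    (h : ∀ E, MeasurableSet[m] E → ∫⁻ x in E, f x ∂μ = μ (A ∩ E)) :
    ∀ᵐ x ∂μ, condExpKernel μ m x A = f x := by
  refine ae_eq_of_ae_eq_trim (hm := hm) ?_
  have hK : Measurable[m] fun x => condExpKernel μ m x A := Kernel.measurable_coe _ hA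
  refine ae_eq_of_forall_setLIntegral_eq_of_sigmaFinite hK hf fun E hE _ => ?_
  rw [setLIntegral_trim hm hK hE, setLIntegral_trim hm hf hE, h E hE]
  have h1 := setLIntegral_lintegral_condExpKernel hm hE (μ := μ) (measurable_one.indicator hA)
  simp only [lintegral_indicator_one hA] at h1
  rw [h1, Measure.restrict_apply hA]

/-- A measurable family of measures which satisfies the defining property of conditional measures
agrees almost everywhere with the conditional measures. -/
theorem condExpKernel_ae_eq (hm : m ≤ mΩ) {κ : Ω → Measure Ω}
    (hκ : ∀ A, MeasurableSet A → Measurable[m] fun x => κ x A)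
    (h : ∀ A E, MeasurableSet A → MeasurableSet[m] E → ∫⁻ x in E, κ x A ∂μ = μ (A ∩ E)) :
    ∀ᵐ x ∂μ, condExpKernel μ m x = κ x := by
  let C := generateSetAlgebra (MeasurableSpace.countableGeneratingSet Ω)
  have hC : C.Countable := countable_generateSetAlgebra
    MeasurableSpace.countable_countableGeneratingSet
  have hgen : mΩ = MeasurableSpace.generateFrom C := by
    rw [generateFrom_generateSetAlgebra_eq, MeasurableSpace.generateFrom_countableGeneratingSet]
  have hCm : ∀ A ∈ C, MeasurableSet A := fun A hA => by
    rw [hgen]; exact MeasurableSpace.measurableSet_generateFrom hA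
  have h1 : ∀ᵐ x ∂μ, ∀ A ∈ C, condExpKernel μ m x A = κ x A :=
    (ae_ball_iff hC).2 fun A hA => condExpKernel_apply_ae_eq hm (hCm A hA) (hκ A (hCm A hA))
      fun E hE => h A E (hCm A hA) hE
  have h2 : ∀ᵐ x ∂μ, condExpKernel μ m x Set.univ = κ x Set.univ :=
    condExpKernel_apply_ae_eq hm MeasurableSet.univ (hκ _ MeasurableSet.univ)
      fun E hE => h _ E MeasurableSet.univ hE
  filter_upwards [h1, h2] with x hx hx'
  exact ext_of_generate_finite C hgen isSetAlgebra_generateSetAlgebra.isSetRing.isSetSemiring.isPiSystem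
    hx hx'

/-- Almost surely each set of a countable generating sequence has conditional mass 0 or 1 according
to whether it contains `x`. The complement of the atom is a countable union of null sets. -/
theorem ae_condExpKernel_compl_measurableAtom (hm : m ≤ mΩ)
    (hcg : @MeasurableSpace.CountablyGenerated Ω m) :
    ∀ᵐ x ∂μ, condExpKernel μ m x (@measurableAtom Ω m x)ᶜ = 0 := by
  let A := @MeasurableSpace.natGeneratingSequence Ω m hcg
  have hA : ∀ n, MeasurableSet[m] (A n) :=
    @MeasurableSpace.measurableSet_natGeneratingSequence Ω m hcg
  have hind : ∀ s, MeasurableSet[m] s → ∀ᵐ x ∂μ, condExpKernel μ m x s = s.indicator 1 x := by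
    intro s hs
    refine condExpKernel_apply_ae_eq hm (hm _ hs) (Measurable.indicator (measurable_const (a := 1)) hs) fun E hE => ?_
    rw [lintegral_indicator_one (hm _ hs), Measure.restrict_apply (hm _ hs)]
  have h1 : ∀ᵐ x ∂μ, ∀ n, condExpKernel μ m x (A n) = (A n).indicator 1 x :=
    ae_all_iff.2 fun n => hind _ (hA n)
  have h2 : ∀ᵐ x ∂μ, ∀ n, condExpKernel μ m x (A n)ᶜ = (A n)ᶜ.indicator 1 x :=
    ae_all_iff.2 fun n => hind _ (hA n).compl
  filter_upwards [h1, h2] with x hx1 hx2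
  have hsub : (@measurableAtom Ω m x)ᶜ ⊆
      ⋃ n, {y | ¬ (y ∈ A n ↔ x ∈ A n)} := by
    rw [@MeasurableSpace.measurableAtom_eq_countablyGeneratedAtom_natGeneratingSequence Ω m hcg x]
    intro y hy
    simp only [MeasurableSpace.countablyGeneratedAtom, Set.mem_compl_iff, Set.mem_iInter,
      not_forall] at hy
    obtain ⟨n, hn⟩ := hy
    refine Set.mem_iUnion.2 ⟨n, fun hiff => hn ?_⟩
    by_cases hx : x ∈ A n
    · simpa [A, hx] using (hiff.2 hx)
    · have : y ∉ A n := fun h => hx (hiff.1 h)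
      simpa [A, hx] using this
  refine measure_mono_null hsub (measure_iUnion_null fun n => ?_)
  by_cases hx : x ∈ A n
  · have : {y | ¬ (y ∈ A n ↔ x ∈ A n)} = (A n)ᶜ := by ext y; simp [hx]
    rw [this, hx2 n]
    simp [hx]
  · have : {y | ¬ (y ∈ A n ↔ x ∈ A n)} = A n := by ext y; simp [hx]
    rw [this, hx1 n]
    simp [hx]

end

section

variable {Ω : Type*} {m₁ m₂ : MeasurableSpace Ω} [mΩ : MeasurableSpace Ω] [StandardBorelSpace Ω]
  {μ : Measure Ω} [IsFiniteMeasure μ]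

theorem condExpKernel_tower (h₁₂ : m₁ ≤ m₂) (h₂ : m₂ ≤ mΩ) :
    ∀ᵐ x ∂μ, ∀ A, MeasurableSet A →
      condExpKernel μ m₁ x A = ∫⁻ y, condExpKernel μ m₂ y A ∂condExpKernel μ m₁ x := by
  have hm2 : Measurable fun y => condExpKernel μ m₂ y :=
    (Kernel.measurable (condExpKernel μ m₂)).mono h₂ le_rfl
  have hval : ∀ x A, MeasurableSet A → (condExpKernel μ m₁ x).bind (condExpKernel μ m₂) A =
      ∫⁻ y, condExpKernel μ m₂ y A ∂condExpKernel μ m₁ x := fun x A hA =>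
    Measure.bind_apply hA hm2.aemeasurable
  have hmA : ∀ A, MeasurableSet A → Measurable fun y => condExpKernel μ m₂ y A := fun A hA =>
    (Measure.measurable_coe hA).comp hm2
  have h := condExpKernel_ae_eq (h₁₂.trans h₂) (μ := μ)
    (κ := fun x => (condExpKernel μ m₁ x).bind (condExpKernel μ m₂))
    (fun A hA => by simp only [hval _ A hA]; exact (hmA A hA).lintegral_kernel)
    (fun A E hA hE => by
      simp only [hval _ A hA]
      rw [setLIntegral_lintegral_condExpKernel (h₁₂.trans h₂) hE (hmA A hA)]
      have h1 := setLIntegral_lintegral_condExpKernel h₂ (h₁₂ _ hE) (μ := μ)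
        (measurable_one.indicator hA)
      simp only [lintegral_indicator_one hA] at h1
      rw [h1, Measure.restrict_apply hA])
  filter_upwards [h] with x hx A hA
  conv_lhs => rw [hx]
  exact hval x A hA

/-- On the atoms of a finer countably generated σ-algebra, conditional measures for the coarser one
are multiples of those for the finer one. -/
theorem condExpKernel_restrict_measurableAtom (h₁₂ : m₁ ≤ m₂) (h₂ : m₂ ≤ mΩ)
    (hcg : @MeasurableSpace.CountablyGenerated Ω m₂) :
    ∀ᵐ x ∂μ, (condExpKernel μ m₁ x).restrict (@measurableAtom Ω m₂ x) =
      condExpKernel μ m₁ x (@measurableAtom Ω m₂ x) • condExpKernel μ m₂ x := by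
  have hat : ∀ x, MeasurableSet[m₂] (@measurableAtom Ω m₂ x) :=
    fun x => @MeasurableSpace.measurableSet_measurableAtom Ω m₂ hcg x
  filter_upwards [condExpKernel_tower h₁₂ h₂,
    ae_ae_condExpKernel (h₁₂.trans h₂) (ae_condExpKernel_compl_measurableAtom h₂ hcg)] with x hx hx'
  refine Measure.ext fun A hA => ?_
  rw [Measure.restrict_apply hA, hx _ (hA.inter (h₂ _ (hat x))), Measure.smul_apply, smul_eq_mul,
    mul_comm, ← setLIntegral_const, ← lintegral_indicator (h₂ _ (hat x))]
  -- The finer conditional measure is constant on its atom, and from any other atom it almost surely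
  -- gives no mass to this one.
  refine lintegral_congr_ae ?_
  filter_upwards [hx'] with y hy
  by_cases hyx : y ∈ @measurableAtom Ω m₂ x
  · rw [Set.indicator_of_mem hyx, ← Kernel.apply_congr_of_mem_measurableAtom _ hyx,
      ← @measurableAtom_eq_of_mem Ω m₂ _ _ hyx]
    exact measure_inter_conull hy
  · rw [Set.indicator_of_notMem hyx]
    refine measure_mono_null ?_ hy
    have := @disjoint_measurableAtom_of_notMem Ω m₂ _ _ hyx
    exact fun z hz hzy => Set.disjoint_left.1 this hzy hz.2

end

theorem ae_uniformOn_fiber_compl {X X' : Type*} [MeasurableSpace X] [MeasurableSpace X']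
    {π : X → X'} {x' : X'} (hfin : (π ⁻¹' {x'}).Finite) [MeasurableSingletonClass X] :
    ∀ᵐ y ∂uniformOn (π ⁻¹' {x'}), π y = x' := by
  have : uniformOn (π ⁻¹' {x'}) (π ⁻¹' {x'})ᶜ = 0 := by
    rw [uniformOn_eq_zero_iff hfin, Set.inter_compl_self]
  exact this

/-- The conditional measures with respect to a σ-algebra lifted from a finite-to-one factor are
obtained from those of the factor by means of the uniform measures on the fibres. -/
theorem condExpKernel_comap_ae_eq {X X' : Type*} [mX : MeasurableSpace X] [StandardBorelSpace X]
    {m' : MeasurableSpace X'} [mX' : MeasurableSpace X'] [StandardBorelSpace X'] {π : X → X'} (hπ : Measurable π)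
    (hfin : ∀ x', (π ⁻¹' {x'}).Finite) {μ : Measure X} [IsFiniteMeasure μ] {σ : Kernel X' X}
    (hσ : ∀ᵐ x' ∂μ.map π, σ x' = uniformOn (π ⁻¹' {x'}))
    {ρ : X → ENNReal} (hρ : Measurable ρ) (hμ : ((μ.map π).bind σ).withDensity ρ = μ)
    (hm' : m' ≤ mX') :
    ∀ᵐ x ∂μ, condExpKernel μ (m'.comap π) x =
      ((condExpKernel (μ.map π) m' (π x)).bind σ).withDensity ρ := by
  have hm : m'.comap π ≤ mX := (MeasurableSpace.comap_mono hm').trans hπ.comap_le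
  have hind : ∀ A : Set X, MeasurableSet A → Measurable (A.indicator ρ) := fun A hA =>
    hρ.indicator hA
  have hval : ∀ (ν : Measure X') (A : Set X), MeasurableSet A → (ν.bind σ).withDensity ρ A =
      ∫⁻ x', ∫⁻ y, A.indicator ρ y ∂σ x' ∂ν := by
    intro ν A hA
    rw [withDensity_apply _ hA, ← lintegral_indicator hA,
      Measure.lintegral_bind σ.aemeasurable (hind A hA).aemeasurable]
  have hmeas : ∀ A : Set X, MeasurableSet A → Measurable[m'] fun z =>
      ∫⁻ x', ∫⁻ y, A.indicator ρ y ∂σ x' ∂condExpKernel (μ.map π) m' z := fun A hA =>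
    (hind A hA).lintegral_kernel.lintegral_kernel
  refine condExpKernel_ae_eq hm (fun A hA => ?_) fun A E hA hE => ?_
  · simp only [hval _ A hA]
    exact (hmeas A hA).comp (comap_measurable π)
  · obtain ⟨E, hE, rfl⟩ := hE
    simp only [hval _ A hA]
    -- No normalizing factor is needed: the projection of `μ` is exactly the base measure `μ.map π`,
    -- so integrating the inner conditional measures returns the integral over the base.
    rw [← setLIntegral_map (hm' _ hE) ((hmeas A hA).mono hm' le_rfl) hπ,
      setLIntegral_lintegral_condExpKernel hm' hE (hind A hA).lintegral_kernel,
      ← lintegral_indicator (hm' _ hE)]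
    conv_rhs => rw [← hμ, hval _ _ (hA.inter (hπ (hm' _ hE)))]
    refine lintegral_congr_ae ?_
    filter_upwards [hσ] with x' hx'
    rw [hx']
    by_cases hxE : x' ∈ E
    · rw [Set.indicator_of_mem hxE, hx']
      refine lintegral_congr_ae ?_
      filter_upwards [ae_uniformOn_fiber_compl (hfin x')] with y hy
      by_cases hyA : y ∈ A
      · rw [Set.indicator_of_mem hyA, Set.indicator_of_mem (Set.mem_inter hyA (show π y ∈ E from hy ▸ hxE))]
      · rw [Set.indicator_of_notMem hyA, Set.indicator_of_notMem fun h => hyA h.1]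
    · rw [Set.indicator_of_notMem hxE, eq_comm, lintegral_eq_zero_iff (hind _ (hA.inter (hπ (hm' _ hE))))]
      filter_upwards [ae_uniformOn_fiber_compl (hfin x')] with y hy
      refine Set.indicator_of_notMem (fun h => hxE ?_) _
      rw [← hy]; exact h.2

/-- An invariant measure on a finite extension has an invariant density, constant along the orbits
of an expanded group, with respect to the measure that is uniform on the fibres. -/
theorem exists_smul_invariant_density {U X X' : Type*} [Group U] [MetricSpace U]
    [IsTopologicalGroup U] [LocallyCompactSpace U] [TopologicalSpace X] [T2Space X]
    [LocallyCompactSpace X] [SecondCountableTopology X] [MeasurableSpace X] [BorelSpace X]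
    [TopologicalSpace X'] [T2Space X'] [LocallyCompactSpace X'] [SecondCountableTopology X']
    [MeasurableSpace X'] [BorelSpace X'] [MulAction U X] [ContinuousSMul U X]
    {θ : U ≃* U} {T : X ≃ₜ X} {T' : X' ≃ₜ X'}
    (hT : ∀ (u : U) (x : X), T (u • x) = θ u • T x) {c : ℝ} (hc : 1 < c)
    (hexp : ∀ u₁ u₂ : U, c * dist u₁ u₂ ≤ dist (θ u₁) (θ u₂)) {π : X → X'} (hπ : Measurable π)
    (hfin : ∀ x', (π ⁻¹' {x'}).Finite) (hπT : ∀ x, π (T x) = T' (π x))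
    {μ : Measure X} [IsFiniteMeasure μ] (hμ : MeasurePreserving T μ μ) :
    ∃ (σ : Kernel X' X) (ρ : X → ENNReal), (∀ᵐ x' ∂μ.map π, σ x' = uniformOn (π ⁻¹' {x'})) ∧
      Measurable ρ ∧ (∀ (u : U) (x : X), ρ (u • x) = ρ x) ∧ (∀ x, ρ x ≠ ⊤) ∧
      ((μ.map π).bind σ).withDensity ρ = μ := by
  obtain ⟨σ, hσf, hσ⟩ := exists_kernel_uniformOn_fiber hπ hfin (μ.map π)
  have hac := absolutelyContinuous_bind_uniformOn_fiber hπ hfin hσ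
  have hT2 : MeasurePreserving T ((μ.map π).bind σ) ((μ.map π).bind σ) :=
    measurePreserving_bind_uniformOn_fiber hπ hfin hσ T.toMeasurableEquiv T'.toMeasurableEquiv
      hπT hμ
  -- Both measures are `T`-invariant, so their Radon–Nikodym derivative is too.
  have h1 := T.measurableEmbedding.rnDeriv_map μ ((μ.map π).bind σ)
  rw [hμ.map_eq, hT2.map_eq] at h1
  obtain ⟨ρ, hρ, hinv, hae⟩ := exists_smul_invariant_ae_eq hT hc hexp hT2
    (ρ := fun x => (μ.rnDeriv ((μ.map π).bind σ) x).toReal) Measure.integrable_toReal_rnDeriv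
    (by filter_upwards [h1] with x hx; rw [hx])
  refine ⟨σ, fun x => ENNReal.ofReal (ρ x), hσ, hρ.ennreal_ofReal, fun u x => by simp only [hinv],
    fun x => ENNReal.ofReal_ne_top, ?_⟩
  have h2 : (fun x => ENNReal.ofReal (ρ x)) =ᵐ[(μ.map π).bind σ]
      μ.rnDeriv ((μ.map π).bind σ) := by
    filter_upwards [hae, μ.rnDeriv_ne_top ((μ.map π).bind σ)] with x hx hx'
    rw [hx, ENNReal.ofReal_toReal hx']
  rw [withDensity_congr_ae h2, Measure.withDensity_rnDeriv_eq _ _ hac]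

/-! ### Atoms and local plaque fields -/

/-- The sets that do not separate `x` from `y` form a σ-algebra, so generators suffice. -/
theorem mem_measurableAtom_generateFrom {X : Type*} {S : Set (Set X)} {x y : X} :
    y ∈ @measurableAtom X (MeasurableSpace.generateFrom S) x ↔ ∀ s ∈ S, (x ∈ s ↔ y ∈ s) := by
  constructor
  · intro h s hs
    have hms : MeasurableSet[MeasurableSpace.generateFrom S] s :=
      MeasurableSpace.measurableSet_generateFrom hs
    refine ⟨fun hx => @mem_of_mem_measurableAtom X (MeasurableSpace.generateFrom S) _ _ h _ hms hx,
      fun hy => ?_⟩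
    by_contra hx
    exact @mem_of_mem_measurableAtom X (MeasurableSpace.generateFrom S) _ _ h _ hms.compl hx hy
  · intro h
    have key : ∀ s, MeasurableSet[MeasurableSpace.generateFrom S] s → (x ∈ s ↔ y ∈ s) := by
      intro s hs
      induction s, hs using MeasurableSpace.generateFrom_induction with
      | hC t ht _ => exact h t ht
      | empty => simp
      | compl t _ ih => simp [ih]
      | iUnion t _ ih => simp [ih]
    simp only [measurableAtom, Set.mem_iInter]
    exact fun s hx hs => (key s hs).1 hx

theorem mem_measurableAtom_comap {X Y : Type*} {m : MeasurableSpace Y} {f : X → Y} {x y : X} :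
    y ∈ @measurableAtom X (m.comap f) x ↔ f y ∈ @measurableAtom Y m (f x) := by
  simp only [measurableAtom, Set.mem_iInter]
  constructor
  · exact fun h s hx hs => h (f ⁻¹' s) hx ⟨s, hs, rfl⟩
  · rintro h _ hx ⟨s, hs, rfl⟩
    exact h s hx hs

theorem mem_measurableAtom_sup {X : Type*} {m₁ m₂ : MeasurableSpace X} {x y : X} :
    y ∈ @measurableAtom X (m₁ ⊔ m₂) x ↔
      y ∈ @measurableAtom X m₁ x ∧ y ∈ @measurableAtom X m₂ x := by
  have h : ∀ m : MeasurableSpace X, m = MeasurableSpace.generateFrom {s | MeasurableSet[m] s} :=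
    fun m => (@MeasurableSpace.generateFrom_measurableSet X m).symm
  have h12 : m₁ ⊔ m₂ =
      MeasurableSpace.generateFrom ({s | MeasurableSet[m₁] s} ∪ {s | MeasurableSet[m₂] s}) := by
    rw [← MeasurableSpace.generateFrom_sup_generateFrom, ← h, ← h]
  rw [h12, mem_measurableAtom_generateFrom]
  conv_rhs => rw [h m₁, h m₂, mem_measurableAtom_generateFrom, mem_measurableAtom_generateFrom]
  constructor
  · exact fun h => ⟨fun s hs => h s (Or.inl hs), fun s hs => h s (Or.inr hs)⟩
  · rintro ⟨h1, h2⟩ s (hs | hs)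
    exacts [h1 s hs, h2 s hs]

/-- `𝓐` is a countably generated σ-algebra of Borel sets whose atoms at the points of `O` are
plaques, uniformly: they contain `B • x` and are contained in `K • x`. -/
structure IsPlaqueField {U X : Type*} [Group U] [TopologicalSpace U] [MulAction U X]
    (𝓑 𝓐 : MeasurableSpace X) (O : Set X) (B K : Set U) : Prop where
  le : 𝓐 ≤ 𝓑
  countablyGenerated : @MeasurableSpace.CountablyGenerated X 𝓐
  mem_nhds : B ∈ 𝓝 (1 : U)
  isCompact : IsCompact K
  inner : ∀ x ∈ O, ∀ u ∈ B, u • x ∈ @measurableAtom X 𝓐 x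
  outer : ∀ x ∈ O, ∀ y ∈ @measurableAtom X 𝓐 x, ∃ u ∈ K, u • x = y

theorem IsPlaqueField.subordinateOn {U X : Type*} [Group U] [TopologicalSpace U] [MulAction U X]
    {𝓑 𝓐 : MeasurableSpace X} {O : Set X} {B K : Set U} (h : IsPlaqueField 𝓑 𝓐 O B K) :
    SubordinateOn U 𝓑 𝓐 O where
  le := h.le
  countablyGenerated := h.countablyGenerated
  isPlaque x hx := by
    refine ⟨⟨B, h.mem_nhds, ?_⟩, ⟨K, h.isCompact, h.outer x hx⟩⟩
    rintro _ ⟨u, hu, rfl⟩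
    exact h.inner x hx u hu

/-- Renormalization of plaques: with `S = T` the windows shrink by `θ⁻¹`, with `S = T.symm` they
grow by `θ`. -/
theorem IsPlaqueField.comap {U X : Type*} [Group U] [TopologicalSpace U] [MulAction U X]
    {𝓑 𝓐 : MeasurableSpace X} {O : Set X} {B K : Set U} (h : IsPlaqueField 𝓑 𝓐 O B K)
    {S : X → X} (hS : Measurable[𝓑, 𝓑] S) (hSi : Function.Injective S) {τ : U ≃* U}
    (hτ : Continuous τ) (hτs : Continuous τ.symm) (hSτ : ∀ (u : U) (x : X), S (u • x) = τ u • S x) :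
    IsPlaqueField 𝓑 (𝓐.comap S) (S ⁻¹' O) (τ ⁻¹' B) (τ ⁻¹' K) where
  le := (MeasurableSpace.comap_mono h.le).trans hS.comap_le
  countablyGenerated := @MeasurableSpace.CountablyGenerated.comap _ _ 𝓐 h.countablyGenerated S
  mem_nhds := hτ.continuousAt.preimage_mem_nhds (by rw [map_one]; exact h.mem_nhds)
  isCompact := by
    have : τ ⁻¹' K = τ.symm '' K := by
      ext u
      refine ⟨fun hu => ⟨τ u, hu, τ.symm_apply_apply u⟩, ?_⟩
      rintro ⟨k, hk, rfl⟩
      simpa using hk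
    rw [this]
    exact h.isCompact.image hτs
  inner x hx u hu := by
    rw [mem_measurableAtom_comap, hSτ]
    exact h.inner _ hx _ hu
  outer x hx y hy := by
    rw [mem_measurableAtom_comap] at hy
    obtain ⟨k, hk, hky⟩ := h.outer _ hx _ hy
    refine ⟨τ.symm k, by simpa using hk, hSi ?_⟩
    rw [hSτ, τ.apply_symm_apply, hky]

theorem IsPlaqueField.exists_iterate {U X : Type*} [Group U] [TopologicalSpace U] [MulAction U X]
    {𝓑 𝓐 : MeasurableSpace X} {O : Set X} {B K : Set U} (h : IsPlaqueField 𝓑 𝓐 O B K)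
    {S : X → X} (hS : Measurable[𝓑, 𝓑] S) (hSi : Function.Injective S) {τ : U ≃* U}
    (hτ : Continuous τ) (hτs : Continuous τ.symm) (hSτ : ∀ (u : U) (x : X), S (u • x) = τ u • S x)
    (n : ℕ) : ∃ 𝓐' : MeasurableSpace X,
      IsPlaqueField 𝓑 𝓐' (S^[n] ⁻¹' O) (τ^[n] ⁻¹' B) (τ^[n] ⁻¹' K) := by
  induction n with
  | zero => exact ⟨𝓐, h⟩
  | succ n ih =>
    obtain ⟨𝓐', h'⟩ := ih
    exact ⟨_, h'.comap hS hSi hτ hτs hSτ⟩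

/-- Near every point of a locally free action there is a σ-algebra with uniform plaques. -/
theorem LocallyFreeAction.exists_isPlaqueField {U X : Type*} [Group U] [TopologicalSpace U]
    [IsTopologicalGroup U] [T2Space U] [LocallyCompactSpace U] [TopologicalSpace X] [T2Space X]
    [LocallyCompactSpace X] [SecondCountableTopology X] [𝓑 : MeasurableSpace X] [BorelSpace X]
    [MulAction U X] [ContinuousSMul U X] (hfree : LocallyFreeAction U X) (x₀ : X) :
    ∃ (O : Set X) (B K : Set U) (𝓐 : MeasurableSpace X), IsOpen O ∧ x₀ ∈ O ∧
      IsPlaqueField 𝓑 𝓐 O B K := by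
  obtain ⟨V₀, hV₀, hinj⟩ := hfree {x₀} isCompact_singleton
  replace hinj := hinj x₀ rfl
  obtain ⟨V₁, hV₁, hV₁c, hV₁s, hV₁V⟩ := exists_closed_nhds_one_inv_eq_mul_subset hV₀
  obtain ⟨K₁, hK₁, hK₁1⟩ := exists_compact_mem_nhds (1 : U)
  obtain ⟨V, hV1, hVc, hVi, hVV⟩ : ∃ V ∈ 𝓝 (1 : U), IsCompact V ∧ (∀ v ∈ V, v⁻¹ ∈ V) ∧
      ∀ v ∈ V, ∀ w ∈ V, v * w ∈ V₀ := by
    refine ⟨V₁ ∩ (K₁ ∩ K₁⁻¹), Filter.inter_mem hV₁ (Filter.inter_mem hK₁1 ?_), ?_, ?_, ?_⟩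
    · exact continuous_inv.continuousAt.preimage_mem_nhds (by rwa [inv_one])
    · exact (hK₁.inter hK₁.inv).inter_left hV₁c
    · rintro v ⟨h1, h2, h3⟩
      refine ⟨by rw [← hV₁s]; exact Set.inv_mem_inv.2 h1, h3, Set.inv_mem_inv.2 h2⟩
    · exact fun v hv w hw => hV₁V (Set.mul_mem_mul hv.1 hw.1)
  have h1V : (1 : U) ∈ V := mem_of_mem_nhds hV1
  have hC : IsCompact (((fun p : U × U => p.1 * p.2) '' V ×ˢ V) \ interior V) :=
    ((hVc.prod hVc).image continuous_mul).diff isOpen_interior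
  -- No `u` in the compact set `V·V \ interior V` fixes `x₀`. By compactness no such `u` joins two
  -- points near `x₀`, which makes `y ∈ V • x` a transitive relation there.
  have hev : ∀ᶠ p : X × X in 𝓝 (x₀, x₀), ∀ u ∈ ((fun p : U × U => p.1 * p.2) '' V ×ˢ V) \ interior V,
      u • p.1 ≠ p.2 := by
    refine hC.eventually_forall_of_forall_eventually fun u hu => ?_
    have hne : u • x₀ ≠ x₀ := by
      intro h
      obtain ⟨⟨p, hp, rfl⟩, hu2⟩ := hu
      have : p.1 * p.2 = 1 := hinj (hVV _ hp.1 _ hp.2) (mem_of_mem_nhds hV₀) (by simpa using h)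
      simp only [this] at hu2
      exact hu2 (mem_interior_iff_mem_nhds.2 hV1)
    have hcl : IsOpen {q : (X × X) × U | q.2 • q.1.1 ≠ q.1.2} :=
      isOpen_ne_fun (by fun_prop) (by fun_prop)
    exact hcl.mem_nhds hne
  rw [nhds_prod_eq] at hev
  obtain ⟨N, hN, hNN⟩ := (Filter.eventually_prod_self_iff (r := fun x y => ∀ u ∈
    ((fun p : U × U => p.1 * p.2) '' V ×ˢ V) \ interior V, u • x ≠ y)).1 hev
  have hloc : ∀ v ∈ V, ∀ w ∈ V, ∀ x ∈ N, (v * w) • x ∈ N → v * w ∈ V := by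
    intro v hv w hw x hx hvw
    by_contra hcon
    exact hNN x hx _ hvw (v * w) ⟨⟨(v, w), ⟨hv, hw⟩, rfl⟩, fun h => hcon (interior_subset h)⟩ rfl
  obtain ⟨Y, hY, hYN, hYc⟩ := local_compact_nhds hN
  obtain ⟨b, hb⟩ := ((TopologicalSpace.countable_countableBasis X).insert ∅).exists_eq_range
    (Set.insert_nonempty _ _)
  -- Saturations of compact pieces of `Y` are compact after intersecting with `Y`, hence Borel. They
  -- generate a σ-algebra whose atoms in `Y` are the equivalence classes.
  let S : ℕ → Set X := fun n => (fun p : U × X => p.1 • p.2) '' (V ×ˢ (closure (b n) ∩ Y)) ∩ Y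
  have hS : ∀ n, MeasurableSet (S n) := fun n =>
    (((hVc.prod (hYc.inter_left isClosed_closure)).image continuous_smul).inter hYc).measurableSet
  have hatom : ∀ x ∈ Y, ∀ y, y ∈ @measurableAtom X
      (MeasurableSpace.generateFrom (insert Y (Set.range S))) x ↔ y ∈ Y ∧ ∃ v ∈ V, v • x = y := by
    intro x hx y
    rw [mem_measurableAtom_generateFrom]
    constructor
    · intro h
      have hyY : y ∈ Y := (h Y (Set.mem_insert _ _)).1 hx
      refine ⟨hyY, ?_⟩
      by_contra hcon
      have hcl : IsClosed ((fun v : U => v • y) '' V) :=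
        (hVc.image (by fun_prop)).isClosed
      have hxn : ((fun v : U => v • y) '' V)ᶜ ∈ 𝓝 x := by
        refine hcl.isOpen_compl.mem_nhds ?_
        rintro ⟨v, hv, rfl⟩
        exact hcon ⟨v⁻¹, hVi v hv, inv_smul_smul v y⟩
      obtain ⟨F, hF, hFc, hFs⟩ := exists_mem_nhds_isClosed_subset hxn
      obtain ⟨P, hP, hxP, hPF⟩ :=
        (TopologicalSpace.isBasis_countableBasis X).mem_nhds_iff.1 hF
      obtain ⟨n, rfl⟩ : P ∈ Set.range b := hb ▸ Set.mem_insert_of_mem _ hP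
      obtain ⟨⟨⟨v, z⟩, ⟨hv, hz⟩, hvz⟩, -⟩ := (h (S n) (Set.mem_insert_of_mem _ ⟨n, rfl⟩)).1
        ⟨⟨(1, x), ⟨h1V, subset_closure hxP, hx⟩, one_smul U x⟩, hx⟩
      refine hFs (closure_minimal hPF hFc hz.1) ⟨v⁻¹, hVi v hv, ?_⟩
      rw [← hvz]
      exact inv_smul_smul v z
    · have hkey : ∀ x ∈ Y, ∀ y ∈ Y, ∀ v ∈ V, v • x = y → ∀ n, x ∈ S n → y ∈ S n := by
        rintro x - y hyY v hv rfl n ⟨⟨⟨w, z⟩, ⟨hw, hz⟩, rfl⟩, -⟩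
        refine ⟨⟨(v * w, z), ⟨hloc v hv w hw z (hYN hz.2) ?_, hz⟩, mul_smul v w z⟩, hyY⟩
        rw [mul_smul]
        exact hYN hyY
      rintro ⟨hyY, v, hv, hvx⟩ s (rfl | ⟨n, rfl⟩)
      · exact ⟨fun _ => hyY, fun _ => hx⟩
      · exact ⟨hkey x hx y hyY v hv hvx n,
          hkey y hyY x hx v⁻¹ (hVi v hv) (by rw [← hvx, inv_smul_smul]) n⟩
  have hact : ∀ᶠ p : U × X in 𝓝 1 ×ˢ 𝓝 x₀, p.1 • p.2 ∈ Y := by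
    rw [← nhds_prod_eq]
    have hcont : ContinuousAt (fun p : U × X => p.1 • p.2) (1, x₀) := continuous_smul.continuousAt
    refine hcont.eventually_mem ?_
    simpa using hY
  obtain ⟨p, hp, q, hq, hpq⟩ := Filter.eventually_prod_iff.1 hact
  obtain ⟨O, hOs, hO, hxO⟩ := mem_nhds_iff.1 (Filter.inter_mem hq hY)
  refine ⟨O, {u | p u} ∩ V, V, MeasurableSpace.generateFrom (insert Y (Set.range S)), hO, hxO,
    ⟨?_, ?_, Filter.inter_mem hp hV1, hVc, ?_, ?_⟩⟩
  · refine MeasurableSpace.generateFrom_le ?_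
    rintro s (rfl | ⟨n, rfl⟩)
    exacts [hYc.measurableSet, hS n]
  · exact @MeasurableSpace.CountablyGenerated.mk X (MeasurableSpace.generateFrom _)
      ⟨_, (Set.countable_range S).insert Y, rfl⟩
  · intro x hx u hu
    exact (hatom x (hOs hx).2 _).2 ⟨hpq hu.1 (hOs hx).1, u, hu.2, rfl⟩
  · intro x hx y hy
    exact ((hatom x (hOs hx).2 y).1 hy).2

/-! ### Recurrence, trivial stabilizers and proportionality -/

section

variable {U X : Type*} [Group U] [MetricSpace U] [TopologicalSpace X] [MeasurableSpace X]
  [BorelSpace X] [MulAction U X]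

/-- If an expanding map of `U` is implemented by a measure preserving transformation, then almost
every point has trivial stabilizer. -/
theorem LocallyFreeAction.ae_stabilizer_eq_one [LocallyCompactSpace X] [SecondCountableTopology X]
    (hfree : LocallyFreeAction U X) {θ : U ≃* U} {T : X ≃ₜ X}
    (hT : ∀ (u : U) (x : X), T (u • x) = θ u • T x) {c : ℝ} (hc : 1 < c)
    (hexp : ∀ u₁ u₂ : U, c * dist u₁ u₂ ≤ dist (θ u₁) (θ u₂)) {μ : Measure X} [IsFiniteMeasure μ]
    (hμ : MeasurePreserving T μ μ) : ∀ᵐ x ∂μ, ∀ u : U, u • x = x → u = 1 := by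
  have hμs : MeasurePreserving T.symm μ μ := hμ.symm T.toMeasurableEquiv
  have hK : ∀ x : X, ∃ O : Set X, IsOpen O ∧ x ∈ O ∧
      ∃ V ∈ 𝓝 (1 : U), ∀ y ∈ O, Set.InjOn (fun u : U => u • y) V := by
    intro x
    obtain ⟨K, hK, hxK⟩ := exists_compact_mem_nhds x
    obtain ⟨V, hV, h⟩ := hfree K hK
    exact ⟨interior K, isOpen_interior, mem_interior_iff_mem_nhds.2 hxK, V, hV,
      fun y hy => h y (interior_subset hy)⟩
  choose O hO hxO V hV hinj using hK
  obtain ⟨s, hs, hcov⟩ := TopologicalSpace.countable_cover_nhds fun x => (hO x).mem_nhds (hxO x)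
  have hrec : ∀ᵐ x ∂μ, ∀ y ∈ s, x ∈ O y → ∃ᶠ n : ℕ in Filter.atTop, T.symm^[n] x ∈ O y :=
    (ae_ball_iff hs).2 fun y _ => hμs.conservative.ae_mem_imp_frequently_image_mem
      (hO y).measurableSet.nullMeasurableSet
  filter_upwards [hrec] with x hx u hu
  obtain ⟨y, hy, hxy⟩ := Set.mem_iUnion₂.1 (hcov ▸ Set.mem_univ x)
  obtain ⟨n, hn, hnV⟩ := ((hx y hy hxy).and_eventually
    (tendsto_symm_iterate_one hc hexp (hV y) (dist u 1))).exists
  -- At a return time, `θ⁻ⁿ u` fixes `T⁻ⁿ x` and lies in the injectivity neighbourhood, so it is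
  -- trivial.
  have h1 : θ.symm^[n] u • T.symm^[n] x = T.symm^[n] x := by
    have h3 := symm_iterate_smul (T := T.toEquiv) hT n u x
    have h4 : T.symm^[n] (u • x) = θ.symm^[n] u • T.symm^[n] x := h3
    rw [← h4, hu]
  have h2 : θ.symm^[n] u = 1 :=
    hinj y _ hn (hnV u (Metric.mem_closedBall.2 le_rfl)) (mem_of_mem_nhds (hV y))
      (by simpa using h1)
  have h3 : θ.symm^[n] 1 = 1 := iterate_map_one θ.symm n
  exact θ.symm.injective.iterate n (h2.trans h3.symm)

end

theorem Proportional.symm {U : Type*} {_ : MeasurableSpace U} {ν ν' : Measure U}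
    (h : Proportional ν ν') : Proportional ν' ν := by
  obtain ⟨c, h0, h1, rfl⟩ := h
  refine ⟨c⁻¹, ENNReal.inv_ne_zero.2 h1, ENNReal.inv_ne_top.2 h0, ?_⟩
  rw [smul_smul, ENNReal.inv_mul_cancel h0 h1, one_smul]

theorem Proportional.trans {U : Type*} {_ : MeasurableSpace U} {ν₁ ν₂ ν₃ : Measure U}
    (h : Proportional ν₁ ν₂) (h' : Proportional ν₂ ν₃) : Proportional ν₁ ν₃ := by
  obtain ⟨c, h0, h1, rfl⟩ := h
  obtain ⟨c', h0', h1', rfl⟩ := h'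
  exact ⟨c * c', mul_ne_zero h0 h0', ENNReal.mul_ne_top h1 h1', by rw [smul_smul]⟩

theorem Proportional.restrict_of_subset {U : Type*} {_ : MeasurableSpace U} {ν ν' : Measure U}
    {s t : Set U} (hst : s ⊆ t) (h : Proportional (ν.restrict t) (ν'.restrict t)) :
    Proportional (ν.restrict s) (ν'.restrict s) := by
  obtain ⟨c, h0, h1, hc⟩ := h
  refine ⟨c, h0, h1, ?_⟩
  rw [← Measure.restrict_restrict_of_subset hst, hc, Measure.restrict_smul,
    Measure.restrict_restrict_of_subset hst]

theorem Proportional.of_map {U X : Type*} {_ : MeasurableSpace U} {_ : MeasurableSpace X}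
    {f : U → X} (hf : MeasurableEmbedding f) {ν ν' : Measure U}
    (h : Proportional (ν.map f) (ν'.map f)) : Proportional ν ν' := by
  obtain ⟨c, h0, h1, hc⟩ := h
  refine ⟨c, h0, h1, ?_⟩
  rw [← hf.comap_map ν, hc, ← Measure.map_smul, hf.comap_map]

/-- Measures that are proportional on all balls are proportional. -/
theorem Proportional.of_forall_restrict_closedBall {U : Type*} [PseudoMetricSpace U]
    [MeasurableSpace U] [OpensMeasurableSpace U] {ν ν' : Measure U} [IsLocallyFiniteMeasure ν']
    {e : U} (hpos : ∀ N ∈ 𝓝 e, ν' N ≠ 0)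
    (h : ∀ R : ℝ, Proportional (ν.restrict (Metric.closedBall e R))
      (ν'.restrict (Metric.closedBall e R))) : Proportional ν ν' := by
  obtain ⟨N, hN, hNlt⟩ := ν'.finiteAt_nhds e
  obtain ⟨r, hr, hrN⟩ := Metric.nhds_basis_closedBall.mem_iff.1 hN
  have hfin : ν' (Metric.closedBall e r) ≠ ⊤ := (measure_mono hrN |>.trans_lt hNlt).ne
  have hne : ν' (Metric.closedBall e r) ≠ 0 := hpos _ (Metric.closedBall_mem_nhds e hr)
  choose a h0 h1 ha using h
  have hval : ∀ R A, A ⊆ Metric.closedBall e R → ν A = a R * ν' A := by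
    intro R A hA
    have := congrArg (fun τ : Measure U => τ A) (ha R)
    simpa [Measure.restrict_eq_self _ hA] using this
  -- The constants are compared on the small ball, where `ν'` is positive and finite.
  have hconst : ∀ R, r ≤ R → a R = a r := by
    intro R hR
    have h2 := hval R _ (Metric.closedBall_subset_closedBall hR)
    rw [hval r _ le_rfl] at h2
    exact ((ENNReal.mul_left_inj hne hfin).1 h2).symm
  refine ⟨a r, h0 r, h1 r, Measure.ext fun A hA => ?_⟩
  have hmono : Monotone fun n : ℕ => A ∩ Metric.closedBall e (r + n) := fun m n hmn =>
    Set.inter_subset_inter_right _ (Metric.closedBall_subset_closedBall (by gcongr))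
  have hU : A = ⋃ n : ℕ, A ∩ Metric.closedBall e (r + n) := by
    rw [← Set.inter_iUnion, eq_comm, Set.inter_eq_left]
    intro x _
    obtain ⟨n, hn⟩ := exists_nat_ge (dist x e)
    exact Set.mem_iUnion.2 ⟨n, Metric.mem_closedBall.2 (by linarith)⟩
  have hr : ∀ n : ℕ, ν (A ∩ Metric.closedBall e (r + n)) =
      a r * ν' (A ∩ Metric.closedBall e (r + n)) := fun n => by
    rw [hval (r + n) _ Set.inter_subset_right, hconst (r + n) (by simp)]
  rw [Measure.smul_apply, smul_eq_mul]
  conv_lhs => rw [hU, hmono.measure_iUnion]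
  conv_rhs => rw [hU, hmono.measure_iUnion, ENNReal.mul_iSup]
  simp only [hr]

/-- The identity lies in the support of almost every leafwise measure. -/
theorem IsLeafwiseSystem.ae_measure_nhds_one_ne_zero {U X : Type*} [Group U] [MetricSpace U]
    [IsTopologicalGroup U] [LocallyCompactSpace U] [MeasurableSpace U]
    [TopologicalSpace X] [T2Space X] [LocallyCompactSpace X]
    [SecondCountableTopology X] [MeasurableSpace X] [BorelSpace X] [MulAction U X]
    [ContinuousSMul U X] (hfree : LocallyFreeAction U X) {θ : U ≃* U} {T : X ≃ₜ X}
    (hT : ∀ (u : U) (x : X), T (u • x) = θ u • T x) {c : ℝ} (hc : 1 < c)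
    (hexp : ∀ u₁ u₂ : U, c * dist u₁ u₂ ≤ dist (θ u₁) (θ u₂)) (hθ : Continuous θ)
    (hθs : Continuous θ.symm) {μ : Measure X} [IsFiniteMeasure μ]
    (hμ : MeasurePreserving T μ μ) {m : X → Measure U} (hm : IsLeafwiseSystem μ m) :
    ∀ᵐ x ∂μ, ∀ N ∈ 𝓝 (1 : U), m x N ≠ 0 := by
  choose O B K 𝓐 hO hxO hpf using hfree.exists_isPlaqueField
  choose 𝓐' hpf' using fun (x : X) (n : ℕ) => (hpf x).exists_iterate T.continuous.measurable
    T.injective hθ hθs hT n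
  obtain ⟨s, hs, hcov⟩ := TopologicalSpace.countable_cover_nhds fun x => (hO x).mem_nhds (hxO x)
  have hrec : ∀ᵐ x ∂μ, ∀ y ∈ s, x ∈ O y → ∃ᶠ n : ℕ in Filter.atTop, T^[n] x ∈ O y :=
    (ae_ball_iff hs).2 fun y _ => hμ.conservative.ae_mem_imp_frequently_image_mem
      (hO y).measurableSet.nullMeasurableSet
  have hcond : ∀ᵐ x ∂μ, ∀ y ∈ s, ∀ n : ℕ, x ∈ T^[n] ⁻¹' O y →
      Proportional (condMeasure (𝓐' y n) μ x) (plaqueMeasure (𝓐' y n) (m x) x) :=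
    (ae_ball_iff hs).2 fun y _ => ae_all_iff.2 fun n =>
      hm.conditional _ _ (hpf' y n).subordinateOn
  filter_upwards [hrec, hcond, hfree.ae_stabilizer_eq_one hT hc hexp hμ] with x hx hx' hstab N hN h0
  obtain ⟨y, hy, hxy⟩ := Set.mem_iUnion₂.1 (hcov ▸ Set.mem_univ x)
  obtain ⟨R, hR⟩ := (hpf y).isCompact.isBounded.subset_closedBall 1
  obtain ⟨n, hn, hnN⟩ := ((hx y hy hxy).and_eventually
    (tendsto_symm_iterate_one hc hexp hN R)).exists
  obtain ⟨a, ha0, -, ha⟩ := hx' y hy n hn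
  -- At return times the plaque lies in `θ⁻ⁿ K`, inside `N`. If `N` were null, a conditional
  -- probability measure would vanish.
  have hsub : plaqueSet U (𝓐' y n) x ⊆ N := by
    intro u hu
    obtain ⟨k, hk, hku⟩ := (hpf' y n).outer x hn _ hu
    have : u = k := by
      have h1 : k⁻¹ * u = 1 := hstab _ (by rw [mul_smul, ← hku, inv_smul_smul])
      exact (inv_mul_eq_one.1 h1).symm
    rw [this]
    have h2 := hnN _ (hR hk)
    rwa [(Function.LeftInverse.iterate θ.symm_apply_apply n : _) k] at h2
  rw [plaqueMeasure, Measure.restrict_eq_zero.2 (measure_mono_null hsub h0), Measure.map_zero,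
    smul_zero] at ha
  have : Nonempty X := ⟨x⟩
  exact (IsProbabilityMeasure.ne_zero (condExpKernel μ (𝓐' y n) x)) ha

/-! ### Comparison of the leafwise measures -/

/-- On a plaque, the lift to a finite extension of a measure carried by a plaque of the factor is
the corresponding measure on the plaque upstairs. -/
theorem restrict_withDensity_bind_uniformOn {U X X' : Type*} [Group U] [MeasurableSpace U]
    [MeasurableSpace X] [MeasurableSingletonClass X] [MeasurableSpace X'] [MulAction U X]
    [MulAction U X'] {π : X → X'} (hfin : ∀ x', (π ⁻¹' {x'}).Finite)
    (hπU : ∀ (u : U) (x : X), π (u • x) = u • π x) {σ : Kernel X' X} {ρ : X → ENNReal}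
    (hρ : Measurable ρ) (hρU : ∀ (u : U) (x : X), ρ (u • x) = ρ x) {x : X}
    (hmx : Measurable fun u : U => u • x) (hmx' : Measurable fun u : U => u • π x)
    (hstab : ∀ u : U, u • π x = π x → u = 1) {a : Set X} (ha : MeasurableSet a)
    (hax : ∀ y ∈ a, ∃ u : U, u • x = y) {V : Set U} (haV : ∀ u : U, u • x ∈ a → u ∈ V)
    {ν : Measure U} {τ : Measure X'} {c : ENNReal} (hc : c ≠ 0)
    (hτ : τ = c • Measure.map (fun u : U => u • π x) (ν.restrict V))
    (hσ : ∀ᵐ x' ∂τ, σ x' = uniformOn (π ⁻¹' {x'})) :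
    ((τ.bind σ).withDensity ρ).restrict a =
      (c * ((Measure.count (π ⁻¹' {π x}))⁻¹ * ρ x)) •
        Measure.map (fun u : U => u • x) (ν.restrict {u | u • x ∈ a}) := by
  refine Measure.ext fun A hA => ?_
  have hAa := hA.inter ha
  have hind : Measurable ((A ∩ a).indicator ρ) := hρ.indicator hAa
  have hσu : ∀ᵐ u ∂ν.restrict V, σ (u • π x) = uniformOn (π ⁻¹' {u • π x}) := by
    rw [hτ, Measure.ae_ennreal_smul_measure_iff hc] at hσ
    exact ae_of_ae_map hmx'.aemeasurable hσ
  have hfib : ∀ u : U, π ⁻¹' {u • π x} = (fun y => u • y) '' (π ⁻¹' {π x}) := by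
    intro u
    ext y
    constructor
    · intro hy
      refine ⟨u⁻¹ • y, ?_, smul_inv_smul u y⟩
      have hy' : π y = u • π x := hy
      simp [hπU, hy']
    · rintro ⟨y, hy, rfl⟩
      have hy' : π y = π x := hy
      simp [hπU, hy']
  have hval : ∀ u : U, ∫⁻ y, (A ∩ a).indicator ρ y ∂uniformOn (π ⁻¹' {u • π x}) =
      ((Measure.count (π ⁻¹' {π x}))⁻¹ * ρ x) * {u : U | u • x ∈ A ∩ a}.indicator 1 u := by
    intro u
    have hcnt : Measure.count (π ⁻¹' {u • π x}) = Measure.count (π ⁻¹' {π x}) := by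
      rw [hfib, Measure.count_injective_image (MulAction.injective u)]
    rw [lintegral_uniformOn (hfin _), hcnt, mul_assoc]
    congr 1
    -- A point of the fibre lying in `a` has the form `k • x`, and the trivial stabilizer of `π x`
    -- forces `k = u`.
    rw [Finset.sum_eq_single (u • x)]
    · by_cases hu : u • x ∈ A ∩ a
      · rw [Set.indicator_of_mem hu, Set.indicator_of_mem (show u ∈ {u : U | u • x ∈ A ∩ a} from hu),
          hρU, Pi.one_apply, mul_one]
      · rw [Set.indicator_of_notMem hu,
          Set.indicator_of_notMem (show u ∉ {u : U | u • x ∈ A ∩ a} from hu), mul_zero]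
    · intro y hy hne
      refine Set.indicator_of_notMem (fun hya => hne ?_) _
      obtain ⟨k, rfl⟩ := hax y hya.2
      rw [Set.Finite.mem_toFinset] at hy
      have hk : k • π x = u • π x := by rw [← hπU]; exact hy
      have h1 : u⁻¹ * k = 1 := hstab _ (by rw [mul_smul, hk, inv_smul_smul])
      rw [inv_mul_eq_one.1 h1]
    · intro hu
      refine absurd ?_ hu
      rw [Set.Finite.mem_toFinset]
      exact hπU u x
  have hset : MeasurableSet {u : U | u • x ∈ A ∩ a} := hmx hAa
  rw [Measure.restrict_apply hA, withDensity_apply _ hAa, ← lintegral_indicator hAa,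
    Measure.lintegral_bind σ.aemeasurable hind.aemeasurable, hτ, lintegral_smul_measure,
    lintegral_map hind.lintegral_kernel hmx', smul_eq_mul,
    lintegral_congr_ae (g := fun u => ((Measure.count (π ⁻¹' {π x}))⁻¹ * ρ x) *
      {u : U | u • x ∈ A ∩ a}.indicator 1 u)
      (by filter_upwards [hσu] with u hu; rw [hu, hval]),
    lintegral_const_mul _ (measurable_one.indicator hset), lintegral_indicator_one hset,
    Measure.restrict_apply hset, Measure.smul_apply, Measure.map_apply hmx hA,
    Measure.restrict_apply (hmx hA), smul_eq_mul, mul_assoc c]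
  congr 3
  rw [Set.inter_eq_left.2 fun u hu => haV u hu.2]
  rfl

/-- Over plaque fields upstairs and downstairs, the leafwise measures of a measure and of its image
under a finite-to-one map are proportional on the common plaques. -/
theorem ae_proportional_restrict {U X X' : Type*} [Group U] [MetricSpace U] [IsTopologicalGroup U]
    [LocallyCompactSpace U] [SecondCountableTopology U] [MeasurableSpace U] [BorelSpace U]
    [TopologicalSpace X] [T2Space X] [LocallyCompactSpace X] [SecondCountableTopology X]
    {𝓐 : MeasurableSpace X} [𝓑 : MeasurableSpace X] [BorelSpace X]
    [TopologicalSpace X'] [T2Space X'] [LocallyCompactSpace X'] [SecondCountableTopology X']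
    {𝓐' : MeasurableSpace X'} [𝓑' : MeasurableSpace X'] [BorelSpace X']
    [MulAction U X] [ContinuousSMul U X] [MulAction U X'] [ContinuousSMul U X']
    {π : X → X'} (hπ : Measurable π) (hfin : ∀ x', (π ⁻¹' {x'}).Finite)
    (hπU : ∀ (u : U) (x : X), π (u • x) = u • π x)
    {μ : Measure X} [IsFiniteMeasure μ] {σ : Kernel X' X} {ρ : X → ENNReal}
    (hσ : ∀ᵐ x' ∂μ.map π, σ x' = uniformOn (π ⁻¹' {x'}))
    (hρ : Measurable ρ) (hρU : ∀ (u : U) (x : X), ρ (u • x) = ρ x) (hρt : ∀ x, ρ x ≠ ⊤)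
    (hμ : ((μ.map π).bind σ).withDensity ρ = μ)
    (hstab : ∀ᵐ z ∂μ.map π, ∀ u : U, u • z = z → u = 1)
    {m : X → Measure U} (hm : IsLeafwiseSystem μ m)
    {m' : X' → Measure U} (hm' : IsLeafwiseSystem (μ.map π) m')
    (hpos : ∀ᵐ z ∂μ.map π, ∀ N ∈ 𝓝 (1 : U), m' z N ≠ 0)
    {O : Set X} {B K : Set U} (h𝓐 : IsPlaqueField 𝓑 𝓐 O B K)
    {O' : Set X'} {B' K' : Set U}
    (h𝓐' : IsPlaqueField 𝓑' 𝓐' O' B' K') :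
    ∀ᵐ x ∂μ, x ∈ O → π x ∈ O' → ∃ W : Set U, B ∩ B' ⊆ W ∧
      Proportional ((m x).restrict W) ((m' (π x)).restrict W) := by
  have hle' : 𝓐'.comap π ≤ 𝓑 := (MeasurableSpace.comap_mono h𝓐'.le).trans hπ.comap_le
  have hle : 𝓐 ⊔ 𝓐'.comap π ≤ 𝓑 := sup_le h𝓐.le hle'
  have hcg : @MeasurableSpace.CountablyGenerated X (𝓐 ⊔ 𝓐'.comap π) :=
    @MeasurableSpace.CountablyGenerated.sup X 𝓐 (𝓐'.comap π) h𝓐.countablyGenerated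
      (@MeasurableSpace.CountablyGenerated.comap _ _ 𝓐' h𝓐'.countablyGenerated π)
  have hatom : ∀ x y, y ∈ @measurableAtom X (𝓐 ⊔ 𝓐'.comap π) x ↔
      y ∈ @measurableAtom X 𝓐 x ∧ π y ∈ @measurableAtom X' 𝓐' (π x) := fun x y =>
    mem_measurableAtom_sup.trans (and_congr_right fun _ => mem_measurableAtom_comap)
  have hinner : ∀ x ∈ O ∩ π ⁻¹' O', ∀ u ∈ B ∩ B',
      u • x ∈ @measurableAtom X (𝓐 ⊔ 𝓐'.comap π) x := fun x hx u hu => by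
    rw [hatom, hπU]
    exact ⟨h𝓐.inner x hx.1 u hu.1, h𝓐'.inner _ hx.2 u hu.2⟩
  have hsub : IsPlaqueField 𝓑 (𝓐 ⊔ 𝓐'.comap π) (O ∩ π ⁻¹' O') (B ∩ B') K :=
    ⟨hle, hcg, Filter.inter_mem h𝓐.mem_nhds h𝓐'.mem_nhds, h𝓐.isCompact, hinner,
      fun x hx y hy => h𝓐.outer x hx.1 y ((hatom x y).1 hy).1⟩
  have hρ0 : ∀ᵐ x ∂μ, ρ x ≠ 0 := by
    rw [← hμ, ae_withDensity_iff hρ]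
    exact Filter.Eventually.of_forall fun _ h => h
  filter_upwards [hm.conditional _ _ hsub.subordinateOn,
    ae_of_ae_map hπ.aemeasurable (hm'.conditional _ _ h𝓐'.subordinateOn),
    condExpKernel_restrict_measurableAtom (μ := μ) (le_sup_right : 𝓐'.comap π ≤ 𝓐 ⊔ 𝓐'.comap π)
      hle hcg,
    condExpKernel_comap_ae_eq hπ hfin hσ hρ hμ h𝓐'.le,
    ae_of_ae_map hπ.aemeasurable hstab, ae_of_ae_map hπ.aemeasurable hpos, hρ0,
    ae_of_ae_map hπ.aemeasurable (ae_ae_condExpKernel h𝓐'.le hσ)] with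
    x hD hA' hres hlift hst hps hρx hσx hxO hxO'
  specialize hD ⟨hxO, hxO'⟩
  obtain ⟨c, hc0, hct, hc⟩ := hA' hxO'
  have hmx : Continuous fun u : U => u • x := by fun_prop
  have hmx' : Continuous fun u : U => u • π x := by fun_prop
  have hst' : ∀ u : U, u • x = x → u = 1 := fun u hu => hst u (by rw [← hπU, hu])
  have hemb : MeasurableEmbedding fun u : U => u • x := by
    refine hmx.measurableEmbedding fun u v huv => ?_
    have huv' : u • x = v • x := huv
    exact (inv_mul_eq_one.1 (hst' (v⁻¹ * u) (by rw [mul_smul, huv', inv_smul_smul]))).symm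
  have hatm : MeasurableSet (@measurableAtom X (𝓐 ⊔ 𝓐'.comap π) x) :=
    hle _ (@MeasurableSpace.measurableSet_measurableAtom X _ hcg x)
  have hkey := restrict_withDensity_bind_uniformOn (V := plaqueSet U 𝓐' (π x)) hfin hπU hρ hρU
    hmx.measurable hmx'.measurable hst hatm
    (fun y hy => (hsub.outer x ⟨hxO, hxO'⟩ y hy).imp fun u hu => hu.2)
    (fun u hu => by have := ((hatom x _).1 hu).2; rwa [hπU] at this) hc0 hc hσx
  rw [condMeasure, ← hlift, hres] at hkey
  have hWn : {u : U | u • x ∈ @measurableAtom X (𝓐 ⊔ 𝓐'.comap π) x} ∈ 𝓝 (1 : U) :=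
    Filter.mem_of_superset hsub.mem_nhds (hinner x ⟨hxO, hxO'⟩)
  refine ⟨plaqueSet U (𝓐 ⊔ 𝓐'.comap π) x, hinner x ⟨hxO, hxO'⟩, ?_⟩
  refine Proportional.of_map hemb (hD.symm.trans ?_)
  have hcnt0 : Measure.count (π ⁻¹' {π x}) ≠ 0 :=
    Measure.count_ne_zero ⟨x, rfl⟩
  have hcntt : Measure.count (π ⁻¹' {π x}) ≠ ⊤ := (Measure.count_apply_lt_top.2 (hfin _)).ne
  have hc2 : c * ((Measure.count (π ⁻¹' {π x}))⁻¹ * ρ x) ≠ 0 :=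
    mul_ne_zero hc0 (mul_ne_zero (ENNReal.inv_ne_zero.2 hcntt) hρx)
  have hc2t : c * ((Measure.count (π ⁻¹' {π x}))⁻¹ * ρ x) ≠ ⊤ :=
    ENNReal.mul_ne_top hct (ENNReal.mul_ne_top (ENNReal.inv_ne_top.2 hcnt0) (hρt x))
  have : Nonempty X := ⟨x⟩
  -- A null atom would force `m' (π x)` to vanish on a neighbourhood of the identity, against
  -- `hpos`.
  have he0 : condExpKernel μ (𝓐'.comap π) x (@measurableAtom X (𝓐 ⊔ 𝓐'.comap π) x) ≠ 0 := by
    intro he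
    rw [he, zero_smul] at hkey
    have h1 := congrArg (fun κ : Measure X => κ Set.univ) hkey
    simp only [Measure.coe_zero, Pi.zero_apply, Measure.smul_apply, smul_eq_mul] at h1
    rw [Measure.map_apply hmx.measurable MeasurableSet.univ, Set.preimage_univ,
      Measure.restrict_apply_univ] at h1
    exact mul_ne_zero hc2 (hps _ hWn) h1.symm
  have het : condExpKernel μ (𝓐'.comap π) x (@measurableAtom X (𝓐 ⊔ 𝓐'.comap π) x) ≠ ⊤ :=
    measure_ne_top _ _
  refine Proportional.trans ⟨_, ENNReal.inv_ne_zero.2 het, ENNReal.inv_ne_top.2 he0, ?_⟩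
    ⟨_, hc2, hc2t, hkey⟩
  rw [smul_smul, ENNReal.inv_mul_cancel he0 het, one_smul, condMeasure]

theorem mainTheorem6
    -- the group `U`, with a metric inducing its topology
    {U : Type*} [Group U] [MetricSpace U] [IsTopologicalGroup U] [LocallyCompactSpace U]
    [SecondCountableTopology U] [MeasurableSpace U] [BorelSpace U]
    -- the spaces `X` and `X'`
    {X X' : Type*}
    [TopologicalSpace X] [T2Space X] [LocallyCompactSpace X] [SecondCountableTopology X]
    [MeasurableSpace X] [BorelSpace X]
    [TopologicalSpace X'] [T2Space X'] [LocallyCompactSpace X'] [SecondCountableTopology X']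
    [MeasurableSpace X'] [BorelSpace X']
    -- continuous locally free actions of `U`
    [MulAction U X] [ContinuousSMul U X] [MulAction U X'] [ContinuousSMul U X']
    (hfree : LocallyFreeAction U X) (hfree' : LocallyFreeAction U X')
    -- `θ u = a u a⁻¹`, and the actions `T`, `T'` of `a`
    (θ : U ≃* U) (T : X ≃ₜ X) (T' : X' ≃ₜ X')
    (hT : ∀ (u : U) (x : X), T (u • x) = θ u • T x)
    (hT' : ∀ (u : U) (x' : X'), T' (u • x') = θ u • T' x')
    -- `a` uniformly expands the metric of `U`
    (c C : ℝ) (hc : 1 < c) (hC : 1 < C)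
    (hexp : ∀ u₁ u₂ : U,
      c * dist u₁ u₂ ≤ dist (θ u₁) (θ u₂) ∧ dist (θ u₁) (θ u₂) ≤ C * dist u₁ u₂)
    -- the finite-to-one equivariant map
    (π : X → X') (hπ : Measurable π) (hfin : ∀ x' : X', (π ⁻¹' {x'}).Finite)
    (hπT : ∀ x : X, π (T x) = T' (π x))
    (hπU : ∀ (u : U) (x : X), π (u • x) = u • π x)
    -- the `a`-invariant measure
    (μ : Measure X) [IsProbabilityMeasure μ] (hμ : MeasurePreserving T μ μ)
    -- leafwise measures for `μ` and for `π_* μ`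
    (m : X → Measure U) (hm : IsLeafwiseSystem μ m)
    (m' : X' → Measure U) (hm' : IsLeafwiseSystem (μ.map π) m') :
    ∀ᵐ x ∂μ, Proportional (m x) (m' (π x)) := by

  have hexp₁ : ∀ u₁ u₂ : U, c * dist u₁ u₂ ≤ dist (θ u₁) (θ u₂) := fun u₁ u₂ => (hexp u₁ u₂).1
  have hθ : Continuous θ :=
    (LipschitzWith.of_dist_le' fun u₁ u₂ => (hexp u₁ u₂).2).continuous
  have hθs : Continuous θ.symm := by
    refine (LipschitzWith.of_dist_le' (K := c⁻¹) fun u₁ u₂ => ?_).continuous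
    have h1 := hexp₁ (θ.symm u₁) (θ.symm u₂)
    rw [θ.apply_symm_apply, θ.apply_symm_apply] at h1
    rwa [inv_mul_eq_div, le_div_iff₀ (zero_lt_one.trans hc), mul_comm]
  have hμ' : MeasurePreserving T' (μ.map π) (μ.map π) := by
    refine ⟨T'.continuous.measurable, ?_⟩
    rw [Measure.map_map T'.continuous.measurable hπ]
    conv_rhs => rw [← hμ.map_eq, Measure.map_map hπ hμ.measurable]
    congr 1
    ext x
    exact (hπT x).symm
  have hstab := hfree'.ae_stabilizer_eq_one hT' hc hexp₁ hμ'
  have hpos := hm'.ae_measure_nhds_one_ne_zero hfree' hT' hc hexp₁ hθ hθs hμ'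
  obtain ⟨σ, ρ, hσ, hρ, hρU, hρt, hρμ⟩ :=
    exists_smul_invariant_density hT hc hexp₁ hπ hfin hπT hμ
  have hTs : ∀ (u : U) (x : X), T.symm (u • x) = θ.symm u • T.symm x :=
    symm_iterate_smul (T := T.toEquiv) hT 1
  have hTs' : ∀ (u : U) (x : X'), T'.symm (u • x) = θ.symm u • T'.symm x :=
    symm_iterate_smul (T := T'.toEquiv) hT' 1
  have hπTs : ∀ x, π (T.symm x) = T'.symm (π x) := fun x => by
    rw [eq_comm, T'.symm_apply_eq, ← hπT, T.apply_symm_apply]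
  choose O B K 𝓐 hO hxO h𝓐 using hfree.exists_isPlaqueField
  choose O' B' K' 𝓐' hO' hxO' h𝓐' using hfree'.exists_isPlaqueField
  -- Pulling back by `T⁻ⁿ` turns the inner window `B` into `θⁿ B`.
  choose 𝓐n h𝓐n using fun (x : X) (n : ℕ) => (h𝓐 x).exists_iterate T.symm.continuous.measurable
    T.symm.injective hθs hθ hTs n
  choose 𝓐n' h𝓐n' using fun (x : X') (n : ℕ) =>
    (h𝓐' x).exists_iterate T'.symm.continuous.measurable T'.symm.injective hθs hθ hTs' n
  obtain ⟨s, hs, hcov⟩ := TopologicalSpace.countable_cover_nhds fun x => (hO x).mem_nhds (hxO x)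
  obtain ⟨s', hs', hcov'⟩ :=
    TopologicalSpace.countable_cover_nhds fun x => (hO' x).mem_nhds (hxO' x)
  have hμs : MeasurePreserving T.symm μ μ := hμ.symm T.toMeasurableEquiv
  -- Recurrence is applied upstairs to the intersection, so that `x` and `π x` return at the same
  -- times.
  have hrec : ∀ᵐ x ∂μ, ∀ y ∈ s, ∀ y' ∈ s', x ∈ O y ∩ π ⁻¹' O' y' →
      ∃ᶠ n : ℕ in Filter.atTop, T.symm^[n] x ∈ O y ∩ π ⁻¹' O' y' :=
    (ae_ball_iff hs).2 fun y _ => (ae_ball_iff hs').2 fun y' _ =>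
      hμs.conservative.ae_mem_imp_frequently_image_mem
        ((hO y).measurableSet.inter (hπ (hO' y').measurableSet)).nullMeasurableSet
  have hprop : ∀ᵐ x ∂μ, ∀ y ∈ s, ∀ y' ∈ s', ∀ n : ℕ, x ∈ T.symm^[n] ⁻¹' O y →
      π x ∈ T'.symm^[n] ⁻¹' O' y' → ∃ W : Set U, θ.symm^[n] ⁻¹' B y ∩ θ.symm^[n] ⁻¹' B' y' ⊆ W ∧
        Proportional ((m x).restrict W) ((m' (π x)).restrict W) :=
    (ae_ball_iff hs).2 fun y _ => (ae_ball_iff hs').2 fun y' _ => ae_all_iff.2 fun n =>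
      ae_proportional_restrict hπ hfin hπU hσ hρ hρU hρt hρμ hstab hm hm' hpos (h𝓐n y n)
        (h𝓐n' y' n)
  filter_upwards [hrec, hprop, ae_of_ae_map hπ.aemeasurable hpos] with x hx hW hpx
  obtain ⟨y, hy, hxy⟩ := Set.mem_iUnion₂.1 (hcov ▸ Set.mem_univ x)
  obtain ⟨y', hy', hxy'⟩ := Set.mem_iUnion₂.1 (hcov' ▸ Set.mem_univ (π x))
  have := hm'.locallyFinite (π x)
  refine Proportional.of_forall_restrict_closedBall hpx fun R => ?_
  obtain ⟨n, hn, hnB⟩ := ((hx y hy y' hy' ⟨hxy, hxy'⟩).and_eventually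
    (tendsto_symm_iterate_one hc hexp₁
      (Filter.inter_mem (h𝓐 y).mem_nhds (h𝓐' y').mem_nhds) R)).exists
  have hsemi : π (T.symm^[n] x) = T'.symm^[n] (π x) :=
    (Function.Semiconj.iterate_right (f := π) hπTs n) x
  obtain ⟨W, hBW, hWp⟩ := hW y hy y' hy' n hn.1 (by
    rw [Set.mem_preimage, ← hsemi]
    exact hn.2)
  exact hWp.restrict_of_subset fun u hu => hBW (hnB u hu)
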